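/- Let $k$ be fixed, and let $p_1\ge\dots\ge p_k\ge 0$ be fixed with $\sum_{i=1}^k p_i=1$. Each item of an $n$-set belongs, independently of the others, to class $C_i$ with probability $p_i$; this gives a hidden partition of the $n$-set. A query on two items tells whether they are in the same class. Consider the following random algorithm. It keeps an aggregated graph, whose vertices are sets of items known to be in the same class (initially the $n$ singletons) and whose edges (initially none) join vertices known to be in different classes. At each step, as long as there are two distinct non-adjacent vertices, it picks a pair of such vertices uniformly at random and queries an item of one against an item of the other. If the answer is positive, the two vertices are merged into one, which is adjacent to all neighbours of either of them; if the answer is negative, an edge is added between them. The algorithm stops when the aggregated graph is complete, that is, when the partition is recovered. Let $X$ be the number of queries made, and let $Y$ be the number of those queries that compare items of different classes. Then, as $n\to\infty$, $$\mathbb E[X]\sim n-k+\sum_{1\le i<j\le k} f(p_i,p_j)\,n \qquad\text{and}\qquad \mathbb E[Y]\sim\sum_{1\le i<j\le k} f(p_i,p_j)\,n,$$ where $$f(\alpha,\beta)=\begin{cases}2\alpha & \alpha=\beta,\\[2pt] \dfrac{2\alpha\beta\ln(\alpha/\beta)}{\alpha-\beta} & \alpha\ne\beta,\end{cases}$$ with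 $f(\alpha,\beta)=0$ (the limiting value) if $\alpha\neq\beta$ and one of them is $0$. Here $a_n\sim b_n$ means $a_n=b_n+o(b_n)$; in particular, if $b_n$ is identically $0$ (one class of probability $1$), it says that $a_n=0$ for all large $n$. -/

import Mathlib

open Filter Asymptotics
open scoped ENNReal

/-- An aggregated graph on the item set `V`: what is known after some queries. Each vertex is a
set of items known to lie in one common class (the label of the vertex). An edge says that its two
ends are known to lie in different classes. -/
@[ext]
structure AggGraph (V : Type) where
  verts : Finset (Finset V)
  edges : Finset (Sym2 (Finset V))

namespace AggGraph

variable {V : Type} [DecidableEq V]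

/-- The graph before the first query: one vertex for each item, and no edges. -/
def initial (V : Type) [DecidableEq V] [Fintype V] : AggGraph V where
  verts := Finset.univ.image fun v => {v}
  edges := ∅

/-- The undetermined pairs: the pairs of distinct non-adjacent vertices. -/
def undetermined (G : AggGraph V) : Finset (Sym2 (Finset V)) :=
  G.verts.sym2.filter fun e => ¬ e.IsDiag ∧ e ∉ G.edges

/-- The label of the vertex obtained by merging the two vertices of a pair: the union of their
labels. -/
def mergedLabel (e : Sym2 (Finset V)) : Finset V :=
  Sym2.lift ⟨fun a b => a ∪ b, fun a b => Finset.union_comm a b⟩ e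

/-- The graph after a negative answer to the query `e`: the edge `e` is added. -/
def addEdge (G : AggGraph V) (e : Sym2 (Finset V)) : AggGraph V where
  verts := G.verts
  edges := insert e G.edges

/-- The graph after a positive answer to the query `e`: the two vertices of `e` are merged, and the
new vertex is adjacent to all neighbours of either of them. -/
def merge (G : AggGraph V) (e : Sym2 (Finset V)) : AggGraph V where
  verts := insert (mergedLabel e) (G.verts.filter fun c => c ∉ e)
  edges := G.edges.image (Sym2.map fun c => if c ∈ e then mergedLabel e else c)

/-- The answer of the oracle to the query `e`, where `ω` assigns to each item its class: `true` if
the items in the two vertices of `e` are all in the same class. -/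
def answer {ι : Type} [DecidableEq ι] (ω : V → ι) (e : Sym2 (Finset V)) : Bool :=
  decide (∀ u ∈ mergedLabel e, ∀ v ∈ mergedLabel e, ω u = ω v)

/-- The graph after the query `e`. -/
def query {ι : Type} [DecidableEq ι] (ω : V → ι) (G : AggGraph V) (e : Sym2 (Finset V)) :
    AggGraph V :=
  if answer ω e then G.merge e else G.addEdge e

theorem card_verts_merge_lt (G : AggGraph V) {e : Sym2 (Finset V)} (he : e ∈ G.undetermined) :
    (G.merge e).verts.card < G.verts.card := by
  induction e using Sym2.ind with
  | _ a b =>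
    simp only [undetermined, Finset.mem_filter, Finset.mk_mem_sym2_iff, Sym2.mk_isDiag_iff] at he
    obtain ⟨⟨ha, hb⟩, hab, -⟩ := he
    have h1 : G.verts.filter (fun c => c ∉ s(a, b)) = (G.verts.erase a).erase b := by
      ext c
      simp only [Finset.mem_filter, Sym2.mem_iff, Finset.mem_erase]
      tauto
    have hb' : b ∈ G.verts.erase a := Finset.mem_erase.2 ⟨fun h => hab h.symm, hb⟩
    have h2 := Finset.card_erase_add_one hb'
    have h3 := Finset.card_erase_add_one ha
    have h4 := Finset.card_insert_le (mergedLabel s(a, b))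
      (G.verts.filter (fun c => c ∉ s(a, b)))
    rw [h1] at h4
    simp only [merge, h1]
    omega

theorem card_undetermined_addEdge_lt (G : AggGraph V) {e : Sym2 (Finset V)}
    (he : e ∈ G.undetermined) : (G.addEdge e).undetermined.card < G.undetermined.card := by
  apply Finset.card_lt_card
  refine ⟨fun x hx => ?_, fun h => ?_⟩
  · simp only [undetermined, addEdge, Finset.mem_filter, Finset.mem_insert, not_or] at hx ⊢
    tauto
  · have := h he
    simp [undetermined, addEdge] at this

/-- The random algorithm, started from the graph `G` with hidden classes given by `ω`: as long as
there is an undetermined pair, it queries one that is chosen uniformly at random. The value is the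
law of the list of the answers to the queries, in the order in which they are made. -/
noncomputable def randomRun {ι : Type} [DecidableEq ι] (ω : V → ι) (G : AggGraph V) :
    PMF (List Bool) :=
  if h : G.undetermined.Nonempty then
    haveI : Nonempty G.undetermined := h.to_subtype
    (PMF.uniformOfFintype G.undetermined).bind fun e =>
      (randomRun ω (G.query ω e.1)).map (List.cons (answer ω e.1))
  else PMF.pure []
termination_by (G.verts.card, G.undetermined.card)
decreasing_by
  unfold query
  split
  · exact Prod.Lex.left _ _ (G.card_verts_merge_lt e.2)
  · exact Prod.Lex.right _ (G.card_undetermined_addEdge_lt e.2)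

end AggGraph

/-- The expectation of `X`, a function of the list of the answers received by the random algorithm
on `n` items, where each item is independently in class `i` with probability `p i`. -/
noncomputable def expectedCost {k : ℕ} (p : Fin k → ℝ) (n : ℕ) (X : List Bool → ℕ) : ℝ≥0∞ :=
  ∑ ω : Fin n → Fin k, ENNReal.ofReal (∏ u, p (ω u)) *
    ∑' l : List Bool, AggGraph.randomRun ω (AggGraph.initial (Fin n)) l * (X l : ℝ≥0∞)

/-- The expected number of queries made by the random algorithm. -/
noncomputable def expectedQueries {k : ℕ} (p : Fin k → ℝ) (n : ℕ) : ℝ :=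
  (expectedCost p n fun l => l.length).toReal

/-- The expected number of queries made by the random algorithm that compare items of different
classes, that is, of queries that are answered negatively. -/
noncomputable def expectedCrossQueries {k : ℕ} (p : Fin k → ℝ) (n : ℕ) : ℝ :=
  (expectedCost p n fun l => l.count false).toReal

/-- The function `f(α, β)`. For `α ≠ β` with `α = 0` or `β = 0` its value is `0`, the limit of the
formula there. -/
noncomputable def crossRate (α β : ℝ) : ℝ :=
  if α = β then 2 * α else 2 * α * β * Real.log (α / β) / (α - β)

open MeasureTheory Set Topology

/-! Fix the hidden classes. For two of them let a, b be the current numbers of vertices and m the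
number of edges between them. The undetermined pairs include all `a.choose 2` and `b.choose 2` pairs
inside the classes and `a * b - m` cross pairs. If joined cross pairs were queried too, each pair at
rate 1, the counts would follow a' = -a²/2, so a(t) = 2 / (2/a + t), and the number of cross queries
would be the integral of a(t) b(t). That integral is exactly f(a, b) (`crossRate_eq_integral`).
Hence a²/2 ∂f/∂a + b²/2 ∂f/∂b = ab (`crossRateSlope_add`), and with unit differences in place of
derivatives this survives up to an error a + b (`pairDrop_crossRate_le`, `le_pairDrop_crossRate`).

Potentials turn this into bounds on expectations (`meanCost_le`). From above, f plus square roots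
that absorb the discretisation error suffices (`mul_le_pairDrop_crossBound`), since joined pairs
only save queries. From below, the hits that would fall on joined pairs must be few. Until the first
class is down to M vertices the elapsed time is at most 2/M, so they number O(n/M); afterwards all
cross hits together number O(M² + n/M + √n) (`neg_le_pairDrop_sum`). With M large and fixed this is
a small multiple of n (`abs_meanCost_false_sub_le`).

The class sizes deviate from n pᵢ by at most √n in mean, and f is monotone and homogeneous of degree
1, so f(n pᵢ, n pⱼ) = n f(pᵢ, pⱼ) may replace f of the sizes (`abs_crossRate_sub_le`). Each positive
answer removes one vertex, from n down to at most k, so there are between n - k and n of them. -/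

/-! ### Improper integrals of products of `(x + t)⁻¹` -/

theorem hasDerivAt_neg_inv_add {x t : ℝ} (h : x + t ≠ 0) :
    HasDerivAt (fun t => -(x + t)⁻¹) (((x + t) ^ 2)⁻¹) t := by
  have h1 : HasDerivAt (fun t => x + t) 1 t := (hasDerivAt_id t).const_add x
  exact (h1.fun_inv h).fun_neg.congr_deriv (by rw [neg_div, neg_neg, one_div])

theorem tendsto_inv_add_atTop (x : ℝ) : Tendsto (fun t : ℝ => (x + t)⁻¹) atTop (𝓝 0) :=
  tendsto_inv_atTop_zero.comp (tendsto_atTop_add_const_left _ _ tendsto_id)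

theorem integrableOn_inv_add_sq {x : ℝ} (hx : 0 < x) :
    IntegrableOn (fun t => ((x + t) ^ 2)⁻¹) (Ioi 0) := by
  refine integrableOn_Ioi_deriv_of_nonneg' (g := fun t => -(x + t)⁻¹) (l := 0) ?_ ?_ ?_
  · intro t ht
    exact hasDerivAt_neg_inv_add (by have : (0 : ℝ) ≤ t := ht; positivity)
  · intro t ht
    positivity
  · simpa using (tendsto_inv_add_atTop x).neg

theorem integral_inv_add_sq {x : ℝ} (hx : 0 < x) :
    ∫ t in Ioi 0, ((x + t) ^ 2)⁻¹ = x⁻¹ := by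
  rw [integral_Ioi_of_hasDerivAt_of_nonneg' (g := fun t => -(x + t)⁻¹) (l := 0)]
  · simp
  · intro t ht
    exact hasDerivAt_neg_inv_add (by have : (0 : ℝ) ≤ t := ht; positivity)
  · intro t ht
    positivity
  · simpa using (tendsto_inv_add_atTop x).neg

theorem continuousOn_inv_add {x : ℝ} (hx : 0 < x) :
    ContinuousOn (fun t => (x + t)⁻¹) (Ioi 0) := by
  refine ContinuousOn.inv₀ (by fun_prop) fun t ht => ?_
  have : (0 : ℝ) < t := ht
  positivity

theorem integrableOn_of_continuousOn_of_le {f g : ℝ → ℝ} (hf : ContinuousOn f (Ioi 0))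
    (hg : IntegrableOn g (Ioi 0)) (h0 : ∀ t, 0 < t → 0 ≤ f t) (h : ∀ t, 0 < t → f t ≤ g t) :
    IntegrableOn f (Ioi 0) := by
  refine Integrable.mono' hg (hf.aestronglyMeasurable measurableSet_Ioi) ?_
  refine (ae_restrict_iff' measurableSet_Ioi).2 (ae_of_all _ fun t ht => ?_)
  rw [Real.norm_of_nonneg (h0 t ht)]
  exact h t ht

theorem integrableOn_inv_mul_inv {x y : ℝ} (hx : 0 < x) (hy : 0 < y) :
    IntegrableOn (fun t => (x + t)⁻¹ * (y + t)⁻¹) (Ioi 0) := by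
  refine integrableOn_of_continuousOn_of_le
    ((continuousOn_inv_add hx).mul (continuousOn_inv_add hy))
    ((integrableOn_inv_add_sq hx).add (integrableOn_inv_add_sq hy)) ?_ ?_
  · intro t ht
    positivity
  · intro t ht
    simp only [Pi.add_apply, ← inv_pow]
    nlinarith [sq_nonneg ((x + t)⁻¹ - (y + t)⁻¹), sq_nonneg ((x + t)⁻¹), sq_nonneg ((y + t)⁻¹)]

theorem integrableOn_inv_mul_inv_mul_inv {x y z : ℝ} (hx : 0 < x) (hy : 0 < y) (hz : 0 < z) :
    IntegrableOn (fun t => (x + t)⁻¹ * (y + t)⁻¹ * (z + t)⁻¹) (Ioi 0) := by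
  refine integrableOn_of_continuousOn_of_le
    (((continuousOn_inv_add hx).mul (continuousOn_inv_add hy)).mul (continuousOn_inv_add hz))
    ((integrableOn_inv_mul_inv hx hy).mul_const z⁻¹) ?_ ?_
  · intro t ht
    positivity
  · intro t ht
    gcongr
    linarith

theorem setIntegral_Ioi_mono {f g : ℝ → ℝ} (hf : IntegrableOn f (Ioi 0))
    (hg : IntegrableOn g (Ioi 0)) (h : ∀ t, 0 < t → f t ≤ g t) :
    ∫ t in Ioi 0, f t ≤ ∫ t in Ioi 0, g t :=
  setIntegral_mono_on hf hg measurableSet_Ioi fun t ht => h t ht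

theorem integral_inv_mul_inv_of_ne {x y : ℝ} (hx : 0 < x) (hy : 0 < y) (hxy : x ≠ y) :
    ∫ t in Ioi 0, (x + t)⁻¹ * (y + t)⁻¹ = Real.log (x / y) / (x - y) := by
  have hsub : x - y ≠ 0 := sub_ne_zero.2 hxy
  have hlim : Tendsto (fun t : ℝ => (Real.log ((x + t) / (y + t))) / (y - x)) atTop
      (𝓝 (Real.log 1 / (y - x))) := by
    refine Tendsto.div_const ((Real.continuousAt_log one_ne_zero).tendsto.comp ?_) _
    have h1 : Tendsto (fun t : ℝ => 1 + (x - y) * (y + t)⁻¹) atTop (𝓝 (1 + (x - y) * 0)) :=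
      ((tendsto_inv_add_atTop y).const_mul _).const_add _
    simp only [mul_zero, add_zero] at h1
    refine h1.congr' ?_
    filter_upwards [eventually_gt_atTop 0] with t ht
    have h2 : y + t ≠ 0 := by positivity
    field_simp
    ring
  rw [integral_Ioi_of_hasDerivAt_of_nonneg' (g := fun t =>
    (Real.log ((x + t) / (y + t))) / (y - x)) (l := Real.log 1 / (y - x))]
  · simp only [Real.log_one, zero_div, add_zero, zero_sub]
    rw [← div_neg, neg_sub]
  · intro t ht
    have ht' : (0 : ℝ) ≤ t := ht
    have h1 : HasDerivAt (fun t => x + t) 1 t := (hasDerivAt_id t).const_add x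
    have h2 : HasDerivAt (fun t => y + t) 1 t := (hasDerivAt_id t).const_add y
    have h3 := ((h1.fun_div h2 (by positivity)).log (by positivity)).div_const (y - x)
    have h4 : y - x ≠ 0 := sub_ne_zero.2 hxy.symm
    have h5 : x + t ≠ 0 := by positivity
    have h6 : y + t ≠ 0 := by positivity
    refine h3.congr_deriv ?_
    field_simp
    ring
  · intro t ht
    have ht' : (0 : ℝ) < t := ht
    positivity
  · exact hlim

/-! ### The integral form of `crossRate` and its consequences -/

/-- The integrand, with its factor 4, is the product of the solutions 2 / (2/a + t), 2 / (2/b + t)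
of y' = -y²/2. Positivity matters because `2 / 0 = 0`, so zero arguments are treated apart below. -/
theorem crossRate_eq_integral {a b : ℝ} (ha : 0 < a) (hb : 0 < b) :
    crossRate a b = 4 * ∫ t in Ioi 0, (2 / a + t)⁻¹ * (2 / b + t)⁻¹ := by
  unfold crossRate
  split_ifs with h
  · subst h
    simp only [← sq, inv_pow]
    rw [integral_inv_add_sq (by positivity)]
    field_simp
    norm_num
  · rw [integral_inv_mul_inv_of_ne (by positivity) (by positivity)]
    · have h1 : a - b ≠ 0 := sub_ne_zero.2 h
      have h2 : b - a ≠ 0 := sub_ne_zero.2 (Ne.symm h)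
      have h3 : (2 / a / (2 / b)) = (a / b)⁻¹ := by field_simp
      have h4 : 2 / a - 2 / b = 2 * (b - a) / (a * b) := by field_simp
      rw [h3, Real.log_inv, h4]
      field_simp
      ring
    · intro h'
      apply h
      field_simp at h'
      exact h'.symm

theorem crossRate_zero_left (b : ℝ) : crossRate 0 b = 0 := by
  simp [crossRate]

theorem crossRate_zero_right (a : ℝ) : crossRate a 0 = 0 := by
  unfold crossRate
  split_ifs with h <;> simp [h]

theorem crossRate_comm (a b : ℝ) : crossRate a b = crossRate b a := by
  by_cases h : a = b
  · rw [h]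
  · have h1 : a - b ≠ 0 := sub_ne_zero.2 h
    have h2 : b - a ≠ 0 := sub_ne_zero.2 (Ne.symm h)
    rw [crossRate, crossRate, if_neg h, if_neg (Ne.symm h), ← inv_div b a, Real.log_inv]
    field_simp
    ring

theorem crossRate_mul {c : ℝ} (hc : 0 < c) (a b : ℝ) :
    crossRate (c * a) (c * b) = c * crossRate a b := by
  unfold crossRate
  by_cases h : a = b
  · simp [h]; ring
  · have h' : c * a ≠ c * b := fun h' => h (mul_left_cancel₀ hc.ne' h')
    have h1 : a - b ≠ 0 := sub_ne_zero.2 h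
    have h2 : c * a - c * b ≠ 0 := sub_ne_zero.2 h'
    rw [if_neg h, if_neg h', mul_div_mul_left _ _ hc.ne', ← mul_sub]
    field_simp

theorem crossRate_pos {a b : ℝ} (ha : 0 < a) (hb : 0 < b) : 0 < crossRate a b := by
  unfold crossRate
  split_ifs with h
  · positivity
  · rcases lt_or_gt_of_ne h with h | h
    · apply div_pos_of_neg_of_neg
      · exact mul_neg_of_pos_of_neg (by positivity)
          (Real.log_neg (by positivity) ((div_lt_one hb).2 h))
      · linarith
    · apply div_pos
      · exact mul_pos (by positivity) (Real.log_pos ((one_lt_div hb).2 h))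
      · linarith

theorem crossRate_nonneg {a b : ℝ} (ha : 0 ≤ a) (hb : 0 ≤ b) : 0 ≤ crossRate a b := by
  rcases ha.eq_or_lt with rfl | ha
  · rw [crossRate_zero_left]
  rcases hb.eq_or_lt with rfl | hb
  · rw [crossRate_zero_right]
  exact (crossRate_pos ha hb).le

theorem crossRate_mono {a b a' b' : ℝ} (ha : 0 ≤ a) (hb : 0 ≤ b) (haa : a ≤ a') (hbb : b ≤ b') :
    crossRate a b ≤ crossRate a' b' := by
  rcases ha.eq_or_lt with rfl | ha
  · rw [crossRate_zero_left]
    exact crossRate_nonneg haa (hb.trans hbb)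
  rcases hb.eq_or_lt with rfl | hb
  · rw [crossRate_zero_right]
    exact crossRate_nonneg (ha.le.trans haa) hbb
  have ha' := ha.trans_le haa
  have hb' := hb.trans_le hbb
  rw [crossRate_eq_integral ha hb, crossRate_eq_integral ha' hb']
  gcongr ?_ * ?_
  refine setIntegral_Ioi_mono (integrableOn_inv_mul_inv (by positivity) (by positivity))
    (integrableOn_inv_mul_inv (by positivity) (by positivity)) fun t ht => ?_
  gcongr

/-- Weighted AM–GM under the integral sign. The free weight `s` serves very unbalanced arguments:
one at most M, the other at most n, with s = M. -/
theorem crossRate_le {a b s : ℝ} (ha : 0 ≤ a) (hb : 0 ≤ b) (hs : 0 < s) :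
    crossRate a b ≤ s * a + b / s := by
  rcases ha.eq_or_lt with rfl | ha
  · rw [crossRate_zero_left]
    positivity
  rcases hb.eq_or_lt with rfl | hb
  · rw [crossRate_zero_right]
    positivity
  have hx : 0 < 2 / a := by positivity
  have hy : 0 < 2 / b := by positivity
  have h1 := (integrableOn_inv_add_sq hx).const_mul (s / 2)
  have h2 := (integrableOn_inv_add_sq hy).const_mul (1 / (2 * s))
  have h3 : ∫ t in Ioi 0, (2 / a + t)⁻¹ * (2 / b + t)⁻¹ ≤
      ∫ t in Ioi 0, (s / 2 * ((2 / a + t) ^ 2)⁻¹ + 1 / (2 * s) * ((2 / b + t) ^ 2)⁻¹) := by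
    refine setIntegral_Ioi_mono (integrableOn_inv_mul_inv hx hy) (h1.add h2) fun t ht => ?_
    simp only [← inv_pow]
    have h4 : s / 2 * (2 / a + t)⁻¹ ^ 2 + 1 / (2 * s) * (2 / b + t)⁻¹ ^ 2 -
        (2 / a + t)⁻¹ * (2 / b + t)⁻¹ =
        1 / (2 * s) * (s * (2 / a + t)⁻¹ - (2 / b + t)⁻¹) ^ 2 := by
      field_simp
      ring
    have h5 : 0 ≤ 1 / (2 * s) * (s * (2 / a + t)⁻¹ - (2 / b + t)⁻¹) ^ 2 := by positivity
    linarith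
  rw [integral_add h1 h2, integral_const_mul, integral_const_mul, integral_inv_add_sq hx,
    integral_inv_add_sq hy] at h3
  rw [crossRate_eq_integral ha hb]
  calc _ ≤ 4 * _ := mul_le_mul_of_nonneg_left h3 (by norm_num)
    _ = _ := by field_simp; norm_num

/-! ### The decrease of `crossRate` under unit steps -/

/-- The rate at which `crossRate a b` decreases along the flow `a' = - a ^ 2 / 2`. -/
noncomputable def crossRateSlope (a b : ℝ) : ℝ :=
  4 * ∫ t in Ioi 0, (2 / a + t)⁻¹ * (2 / a + t)⁻¹ * (2 / b + t)⁻¹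

theorem crossRateSlope_nonneg {a b : ℝ} (ha : 0 < a) (hb : 0 < b) : 0 ≤ crossRateSlope a b := by
  refine mul_nonneg (by norm_num) (setIntegral_nonneg measurableSet_Ioi fun t ht => ?_)
  have : (0 : ℝ) < t := ht
  positivity

/-- The two integrands add up to minus the derivative of the product of the two factors, whose value
at t = 0 is (a/2)(b/2). -/
theorem crossRateSlope_add {a b : ℝ} (ha : 0 < a) (hb : 0 < b) :
    crossRateSlope a b + crossRateSlope b a = a * b := by
  have hx : 0 < 2 / a := by positivity
  have hy : 0 < 2 / b := by positivity
  unfold crossRateSlope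
  rw [← mul_add, ← integral_add (integrableOn_inv_mul_inv_mul_inv hx hx hy)
    (integrableOn_inv_mul_inv_mul_inv hy hy hx)]
  rw [integral_Ioi_of_hasDerivAt_of_nonneg'
    (g := fun t => -((2 / a + t)⁻¹ * (2 / b + t)⁻¹)) (l := 0)]
  · field_simp
    ring
  · intro t ht
    have ht' : (0 : ℝ) ≤ t := ht
    have h1 : HasDerivAt (fun t => 2 / a + t) 1 t := (hasDerivAt_id t).const_add _
    have h2 : HasDerivAt (fun t => 2 / b + t) 1 t := (hasDerivAt_id t).const_add _
    have h3 := ((h1.fun_inv (by positivity)).fun_mul (h2.fun_inv (by positivity))).fun_neg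
    refine h3.congr_deriv ?_
    have h4 : 2 + a * t ≠ 0 := by positivity
    have h5 : 2 + b * t ≠ 0 := by positivity
    field_simp
    ring
  · intro t ht
    have ht' : (0 : ℝ) < t := ht
    positivity
  · simpa using ((tendsto_inv_add_atTop (2 / a)).mul (tendsto_inv_add_atTop (2 / b))).neg

/-- Since 2/(a-1) - 2/a = 2/(a(a-1)), the difference of the two reciprocal factors is their product
divided by the number of pairs. This is `crossRateSlope` with one of its two equal factors taken at
a - 1. -/
theorem crossRate_sub_eq {a b : ℝ} (ha : 1 < a) (hb : 0 < b) :
    a * (a - 1) / 2 * (crossRate a b - crossRate (a - 1) b) =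
      4 * ∫ t in Ioi 0, (2 / a + t)⁻¹ * (2 / (a - 1) + t)⁻¹ * (2 / b + t)⁻¹ := by
  have ha0 : 0 < a := by linarith
  have ha1 : 0 < a - 1 := by linarith
  have hx : 0 < 2 / a := by positivity
  have hx' : 0 < 2 / (a - 1) := by positivity
  have hy : 0 < 2 / b := by positivity
  rw [crossRate_eq_integral ha0 hb, crossRate_eq_integral ha1 hb, ← mul_sub,
    ← integral_sub (integrableOn_inv_mul_inv hx hy) (integrableOn_inv_mul_inv hx' hy),
    mul_left_comm, ← integral_const_mul]
  congr 1
  refine setIntegral_congr_fun measurableSet_Ioi fun t ht => ?_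
  have ht' : (0 : ℝ) < t := ht
  have h1 : 2 + a * t ≠ 0 := by positivity
  have h2 : 2 + (a - 1) * t ≠ 0 := by positivity
  have h3 : 2 + b * t ≠ 0 := by positivity
  have e1 : 2 / a + t = (2 + a * t) / a := by field_simp
  have e2 : 2 / (a - 1) + t = (2 + (a - 1) * t) / (a - 1) := by field_simp
  have e3 : 2 / b + t = (2 + b * t) / b := by field_simp
  simp only [e1, e2, e3, inv_div]
  field_simp
  ring

theorem crossRate_sub_le {a b : ℝ} (ha : 1 ≤ a) (hb : 0 < b) :
    a * (a - 1) / 2 * (crossRate a b - crossRate (a - 1) b) ≤ crossRateSlope a b := by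
  rcases ha.eq_or_lt with rfl | ha
  · simpa using crossRateSlope_nonneg one_pos hb
  have ha1 : 0 < a - 1 := by linarith
  rw [crossRate_sub_eq ha hb, crossRateSlope]
  gcongr ?_ * ?_
  refine setIntegral_Ioi_mono
    (integrableOn_inv_mul_inv_mul_inv (by positivity) (by positivity) (by positivity))
    (integrableOn_inv_mul_inv_mul_inv (by positivity) (by positivity) (by positivity))
    fun t ht => ?_
  gcongr
  linarith

/-- Passing from a to a - 1 in one factor of the integrand costs at most the ratio (a-1)/a. -/
theorem le_crossRate_sub {a b : ℝ} (ha : 1 ≤ a) (hb : 0 < b) :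
    (1 - 1 / a) * crossRateSlope a b ≤
      a * (a - 1) / 2 * (crossRate a b - crossRate (a - 1) b) := by
  rcases ha.eq_or_lt with rfl | ha
  · simp
  have ha0 : 0 < a := by linarith
  have ha1 : 0 < a - 1 := by linarith
  rw [crossRate_sub_eq ha hb, crossRateSlope, mul_left_comm, ← integral_const_mul]
  gcongr ?_ * ?_
  refine setIntegral_Ioi_mono
    ((integrableOn_inv_mul_inv_mul_inv (by positivity) (by positivity) (by positivity)).const_mul _)
    (integrableOn_inv_mul_inv_mul_inv (by positivity) (by positivity) (by positivity))
    fun t ht => ?_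
  have h1 : (1 - 1 / a) * (2 / a + t)⁻¹ ≤ (2 / (a - 1) + t)⁻¹ := by
    have e1 : 2 / a + t = (2 + a * t) / a := by field_simp
    have e2 : 2 / (a - 1) + t = (2 + (a - 1) * t) / (a - 1) := by field_simp
    rw [e1, e2, inv_div, inv_div]
    have : (1 - 1 / a) * (a / (2 + a * t)) = (a - 1) / (2 + a * t) := by field_simp
    rw [this]
    gcongr
    linarith
  calc _ = (2 / a + t)⁻¹ * ((1 - 1 / a) * (2 / a + t)⁻¹) * (2 / b + t)⁻¹ := by ring
    _ ≤ _ := by gcongr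

/-- The amount by which `g a b` decreases when either argument decreases by one, each weighted by
the number of pairs of objects among that many. -/
noncomputable def pairDrop (g : ℕ → ℕ → ℝ) (a b : ℕ) : ℝ :=
  a.choose 2 * (g a b - g (a - 1) b) + b.choose 2 * (g a b - g a (b - 1))

theorem choose_two_mul_crossRate (a : ℕ) (b : ℝ) :
    (a.choose 2 : ℝ) * (crossRate a b - crossRate (a - 1 : ℕ) b) =
      a * (a - 1) / 2 * (crossRate a b - crossRate (a - 1) b) := by
  rcases a with _ | a
  · simp
  · rw [Nat.cast_choose_two]
    simp

theorem pairDrop_crossRate_le (a b : ℕ) :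
    pairDrop (fun a b => crossRate a b) a b ≤ a * b := by
  rcases a.eq_zero_or_pos with rfl | ha
  · simp [pairDrop, crossRate_zero_left]
  rcases b.eq_zero_or_pos with rfl | hb
  · simp [pairDrop, crossRate_zero_right]
  have ha' : (1 : ℝ) ≤ a := by exact_mod_cast ha
  have hb' : (1 : ℝ) ≤ b := by exact_mod_cast hb
  have h1 := crossRate_sub_le ha' (zero_lt_one.trans_le hb')
  have h2 := crossRate_sub_le hb' (zero_lt_one.trans_le ha')
  have h3 := crossRateSlope_add (zero_lt_one.trans_le ha') (zero_lt_one.trans_le hb')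
  rw [← choose_two_mul_crossRate] at h1 h2
  simp only [pairDrop, crossRate_comm (a : ℝ)]
  rw [crossRate_comm (a : ℝ), crossRate_comm _ (b : ℝ)] at h1
  rw [crossRate_comm _ (b : ℝ)]
  linarith

/-- Each slope is at most ab, so the relative errors 1/a and 1/b cost at most b and a. -/
theorem le_pairDrop_crossRate {a b : ℕ} (ha : 0 < a) (hb : 0 < b) :
    (a * b - a - b : ℝ) ≤ pairDrop (fun a b => crossRate a b) a b := by
  have ha' : (1 : ℝ) ≤ a := by exact_mod_cast ha
  have hb' : (1 : ℝ) ≤ b := by exact_mod_cast hb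
  have ha0 := zero_lt_one.trans_le ha'
  have hb0 := zero_lt_one.trans_le hb'
  have h1 := le_crossRate_sub ha' hb0
  have h2 := le_crossRate_sub hb' ha0
  have h3 := crossRateSlope_add ha0 hb0
  have h4 := crossRateSlope_nonneg ha0 hb0
  have h5 := crossRateSlope_nonneg hb0 ha0
  have h6 : 1 / (a : ℝ) * crossRateSlope a b ≤ b := by
    rw [one_div_mul_eq_div, div_le_iff₀ ha0]
    linarith
  have h7 : 1 / (b : ℝ) * crossRateSlope b a ≤ a := by
    rw [one_div_mul_eq_div, div_le_iff₀ hb0]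
    linarith
  rw [← choose_two_mul_crossRate] at h1 h2
  simp only [pairDrop]
  rw [crossRate_comm (a : ℝ) (b - 1 : ℕ)]
  rw [crossRate_comm (b : ℝ)] at h2
  linarith

/-- A sublinear function whose drop pays for the error a: the product of `a ≤ 2 * (a - 1)` and `1 ≤
2 * a * (√a - √(a - 1))`, which produces the constant 8. -/
theorem le_choose_two_mul_sqrt {a : ℕ} (ha : 2 ≤ a) :
    (a : ℝ) ≤ a.choose 2 * (8 * √a - 8 * √(a - 1 : ℕ)) := by
  rw [Nat.cast_choose_two, Nat.cast_sub (by omega), Nat.cast_one]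
  have ha' : (2 : ℝ) ≤ a := by exact_mod_cast ha
  have h1 : (1 : ℝ) ≤ √a := Real.one_le_sqrt.2 (by linarith)
  have h2 : √((a : ℝ) - 1) ^ 2 = a - 1 := Real.sq_sqrt (by linarith)
  have h3 : √(a : ℝ) ^ 2 = a := Real.sq_sqrt (by linarith)
  have h4 : √((a : ℝ) - 1) ≤ √a := Real.sqrt_le_sqrt (by linarith)
  have h5 : 1 ≤ 2 * √a * (√a - √((a : ℝ) - 1)) := by
    nlinarith [sq_nonneg (√(a : ℝ) - √((a : ℝ) - 1))]
  have h6 : (1 : ℝ) ≤ 2 * a * (√a - √((a : ℝ) - 1)) := by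
    have h7 : √(a : ℝ) ≤ a := by nlinarith
    have h8 : 0 ≤ √a - √((a : ℝ) - 1) := by linarith
    calc (1 : ℝ) ≤ 2 * √a * (√a - √((a : ℝ) - 1)) := h5
      _ ≤ _ := by gcongr
  have h7 : (a : ℝ) ≤ 2 * (a - 1) := by linarith
  calc (a : ℝ) = a * 1 := by ring
    _ ≤ (2 * (a - 1)) * (2 * a * (√a - √((a : ℝ) - 1))) :=
      mul_le_mul h7 h6 zero_le_one (by linarith)
    _ = _ := by ring

/-- `crossRate a b` plus lower order terms that make up for the discreteness of `a` and `b`. -/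
noncomputable def crossBound (a b : ℕ) : ℝ := crossRate a b + 8 * √a + 8 * √b

theorem crossBound_mono {a b a' b' : ℕ} (ha : a ≤ a') (hb : b ≤ b') :
    crossBound a b ≤ crossBound a' b' := by
  have ha' : (a : ℝ) ≤ a' := by exact_mod_cast ha
  have hb' : (b : ℝ) ≤ b' := by exact_mod_cast hb
  unfold crossBound
  gcongr
  exact crossRate_mono (by positivity) (by positivity) ha' hb'

theorem crossBound_nonneg (a b : ℕ) : 0 ≤ crossBound a b := by
  have := crossRate_nonneg (Nat.cast_nonneg' a : (0 : ℝ) ≤ a) (Nat.cast_nonneg' b : (0 : ℝ) ≤ b)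
  unfold crossBound
  positivity

theorem pairDrop_nonneg {g : ℕ → ℕ → ℝ} (hg : ∀ a b a' b', a ≤ a' → b ≤ b' → g a b ≤ g a' b')
    (a b : ℕ) : 0 ≤ pairDrop g a b := by
  have h1 := hg (a - 1) b a b (by omega) le_rfl
  have h2 := hg a (b - 1) a b le_rfl (by omega)
  unfold pairDrop
  have := sub_nonneg.2 h1
  have := sub_nonneg.2 h2
  positivity

/-- The state (1, 1) is excluded because no merge is possible there, so that the drop is 0 while a *
b = 1. -/
theorem mul_le_pairDrop_crossBound {a b : ℕ} (h : ¬ (a = 1 ∧ b = 1)) :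
    (a * b : ℝ) ≤ pairDrop crossBound a b := by
  have hcr : 0 ≤ pairDrop (fun a b => crossRate a b) a b :=
    pairDrop_nonneg (fun a b a' b' ha hb => crossRate_mono (by positivity) (by positivity)
      (by exact_mod_cast ha) (by exact_mod_cast hb)) a b
  have hs : pairDrop crossBound a b = pairDrop (fun a b => crossRate a b) a b +
      a.choose 2 * (8 * √a - 8 * √(a - 1 : ℕ)) + b.choose 2 * (8 * √b - 8 * √(b - 1 : ℕ)) := by
    unfold pairDrop crossBound
    ring
  rcases a.eq_zero_or_pos with rfl | ha
  · simpa using pairDrop_nonneg (fun a b a' b' => crossBound_mono) 0 b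
  rcases b.eq_zero_or_pos with rfl | hb
  · simpa using pairDrop_nonneg (fun a b a' b' => crossBound_mono) a 0
  -- With a single vertex on one side, the product is the size of the other side, and the square
  -- root of that size pays for all of it.
  rcases (show a = 1 ∨ 2 ≤ a by omega) with rfl | ha2
  · have := le_choose_two_mul_sqrt (show 2 ≤ b by omega)
    rw [hs]
    simp
    linarith
  rcases (show b = 1 ∨ 2 ≤ b by omega) with rfl | hb2
  · have := le_choose_two_mul_sqrt ha2
    rw [hs]
    simp
    linarith
  have h1 := le_choose_two_mul_sqrt ha2
  have h2 := le_choose_two_mul_sqrt hb2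
  have h3 := le_pairDrop_crossRate ha hb
  linarith

/-! ### How a query changes the vertices and edges of a consistent graph -/

namespace AggGraph

variable {V ι : Type} [DecidableEq ι]

/-- The pairs of vertices of which one is in class `i` and the other in class `j`. -/
def IsBetween (ω : V → ι) (i j : ι) (e : Sym2 (Finset V)) : Prop :=
  e.map (Finset.image ω) = s({i}, {j})

instance (ω : V → ι) (i j : ι) : DecidablePred (IsBetween ω i j) :=
  fun e => inferInstanceAs (Decidable (e.map (Finset.image ω) = s({i}, {j})))

theorem isBetween_mk_iff {ω : V → ι} {A B : Finset V} {i j a b : ι} (hA : A.image ω = {a})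
    (hB : B.image ω = {b}) :
    IsBetween ω i j s(A, B) ↔ (a = i ∧ b = j) ∨ (a = j ∧ b = i) := by
  simp [IsBetween, hA, hB]

variable [DecidableEq V]

/-- The graph `G` only records true facts about the hidden classes given by `ω`: its vertices are
disjoint non-empty sets of items of one class, its edges join vertices of different classes. -/
structure Consistent (ω : V → ι) (G : AggGraph V) : Prop where
  exists_image_eq : ∀ B ∈ G.verts, ∃ i, B.image ω = {i}
  disjoint : ∀ A ∈ G.verts, ∀ B ∈ G.verts, A ≠ B → Disjoint A B
  edges : ∀ e ∈ G.edges, ∃ A ∈ G.verts, ∃ B ∈ G.verts, e = s(A, B) ∧ A.image ω ≠ B.image ω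

/-- The vertices of `G` whose items are in class `i`. -/
def classVerts (ω : V → ι) (G : AggGraph V) (i : ι) : Finset (Finset V) :=
  G.verts.filter fun B => B.image ω = {i}

/-- The edges of `G` between class `i` and class `j`. -/
def crossEdges (ω : V → ι) (G : AggGraph V) (i j : ι) : Finset (Sym2 (Finset V)) :=
  G.edges.filter (IsBetween ω i j)

/-- The undetermined pairs of `G` between class `i` and class `j`. -/
def openPairs (ω : V → ι) (G : AggGraph V) (i j : ι) : Finset (Sym2 (Finset V)) :=
  G.undetermined.filter (IsBetween ω i j)

theorem mk_mem_undetermined {G : AggGraph V} {A B : Finset V} :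
    s(A, B) ∈ G.undetermined ↔ (A ∈ G.verts ∧ B ∈ G.verts) ∧ A ≠ B ∧ s(A, B) ∉ G.edges := by
  simp [undetermined]

theorem answer_mk {ω : V → ι} {A B : Finset V} {a b : ι} (hA : A.image ω = {a})
    (hB : B.image ω = {b}) : answer ω s(A, B) = decide (a = b) := by
  have hA' : ∀ u ∈ A, ω u = a := fun u hu => by
    simpa [hA] using Finset.mem_image_of_mem ω hu
  have hB' : ∀ u ∈ B, ω u = b := fun u hu => by
    simpa [hB] using Finset.mem_image_of_mem ω hu
  obtain ⟨u, hu, -⟩ := Finset.mem_image.1 (show a ∈ A.image ω by simp [hA])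
  obtain ⟨v, hv, -⟩ := Finset.mem_image.1 (show b ∈ B.image ω by simp [hB])
  refine decide_eq_decide.2 ?_
  simp only [mergedLabel, Sym2.lift_mk]
  constructor
  · intro h
    have := h u (Finset.mem_union_left _ hu) v (Finset.mem_union_right _ hv)
    rwa [hA' u hu, hB' v hv] at this
  · rintro rfl x hx y hy
    have key : ∀ z ∈ A ∪ B, ω z = a := fun z hz =>
      (Finset.mem_union.1 hz).elim (hA' z) (hB' z)
    rw [key x hx, key y hy]

theorem image_union_eq {ω : V → ι} {A B : Finset V} {a : ι} (hA : A.image ω = {a})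
    (hB : B.image ω = {a}) : (A ∪ B).image ω = {a} := by
  rw [Finset.image_union, hA, hB, Finset.union_self]

/-- This makes a merge lower the number of vertices by exactly one: the new label cannot coincide
with an old one. -/
theorem Consistent.union_notMem {ω : V → ι} {G : AggGraph V} (hG : Consistent ω G)
    {A B : Finset V} (hA : A ∈ G.verts) (hB : B ∈ G.verts) (hAB : A ≠ B) :
    A ∪ B ∉ G.verts := by
  intro h
  obtain ⟨a, ha⟩ := hG.exists_image_eq A hA
  obtain ⟨b, hb⟩ := hG.exists_image_eq B hB
  have hA0 : A.Nonempty := Finset.image_nonempty.1 (ha ▸ Finset.singleton_nonempty a)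
  have hB0 : B.Nonempty := Finset.image_nonempty.1 (hb ▸ Finset.singleton_nonempty b)
  have h1 : A ∪ B = A := by
    by_contra hne
    have := hG.disjoint _ h A hA hne
    exact hA0.ne_empty (Finset.disjoint_self_iff_empty A |>.1
      (this.mono_left Finset.subset_union_left))
  have h2 : A ∪ B = B := by
    by_contra hne
    have := hG.disjoint _ h B hB hne
    exact hB0.ne_empty (Finset.disjoint_self_iff_empty B |>.1
      (this.mono_left Finset.subset_union_right))
  exact hAB (h1.symm.trans h2)

theorem merge_verts (G : AggGraph V) (A B : Finset V) :
    (G.merge s(A, B)).verts = insert (A ∪ B) ((G.verts.erase A).erase B) := by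
  simp only [merge, mergedLabel, Sym2.lift_mk]
  congr 1
  ext c
  simp only [Finset.mem_filter, Sym2.mem_iff, Finset.mem_erase]
  tauto

theorem merge_edges (G : AggGraph V) (A B : Finset V) :
    (G.merge s(A, B)).edges =
      G.edges.image (Sym2.map fun c => if c = A ∨ c = B then A ∪ B else c) := by
  simp [merge, mergedLabel]

theorem image_relabel {ω : V → ι} {A B : Finset V} {a : ι} (hA : A.image ω = {a})
    (hB : B.image ω = {a}) (c : Finset V) :
    (if c = A ∨ c = B then A ∪ B else c).image ω = c.image ω := by
  split_ifs with h
  · rw [image_union_eq hA hB]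
    rcases h with rfl | rfl
    · exact hA.symm
    · exact hB.symm
  · rfl

theorem consistent_merge {ω : V → ι} {G : AggGraph V} (hG : Consistent ω G) {A B : Finset V}
    {a : ι} (hA : A ∈ G.verts) (hB : B ∈ G.verts)
    (ha : A.image ω = {a}) (hb : B.image ω = {a}) : Consistent ω (G.merge s(A, B)) where
  exists_image_eq C hC := by
    rw [merge_verts, Finset.mem_insert] at hC
    rcases hC with rfl | hC
    · exact ⟨a, image_union_eq ha hb⟩
    · exact hG.exists_image_eq C (Finset.mem_of_mem_erase (Finset.mem_of_mem_erase hC))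
  disjoint := by
    have key : ∀ C ∈ (G.verts.erase A).erase B, Disjoint (A ∪ B) C := by
      intro C hC
      simp only [Finset.mem_erase] at hC
      exact Finset.disjoint_union_left.2
        ⟨hG.disjoint A hA C hC.2.2 (Ne.symm hC.2.1), hG.disjoint B hB C hC.2.2 (Ne.symm hC.1)⟩
    intro C hC D hD hCD
    rw [merge_verts, Finset.mem_insert] at hC hD
    rcases hC with rfl | hC <;> rcases hD with rfl | hD
    · exact absurd rfl hCD
    · exact key D hD
    · exact (key C hC).symm
    · exact hG.disjoint C (Finset.mem_of_mem_erase (Finset.mem_of_mem_erase hC)) D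
        (Finset.mem_of_mem_erase (Finset.mem_of_mem_erase hD)) hCD
  edges e he := by
    rw [merge_edges, Finset.mem_image] at he
    obtain ⟨e', he', rfl⟩ := he
    obtain ⟨C, hC, D, hD, rfl, hCD⟩ := hG.edges e' he'
    have key : ∀ C ∈ G.verts, (if C = A ∨ C = B then A ∪ B else C) ∈ (G.merge s(A, B)).verts := by
      intro C hC
      rw [merge_verts]
      split_ifs with h
      · exact Finset.mem_insert_self _ _
      · push Not at h
        exact Finset.mem_insert_of_mem
          (Finset.mem_erase.2 ⟨h.2, Finset.mem_erase.2 ⟨h.1, hC⟩⟩)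
    refine ⟨_, key C hC, _, key D hD, rfl, ?_⟩
    rwa [image_relabel ha hb, image_relabel ha hb]

theorem consistent_addEdge {ω : V → ι} {G : AggGraph V} (hG : Consistent ω G) {A B : Finset V}
    (hA : A ∈ G.verts) (hB : B ∈ G.verts) (h : A.image ω ≠ B.image ω) :
    Consistent ω (G.addEdge s(A, B)) where
  exists_image_eq := hG.exists_image_eq
  disjoint := hG.disjoint
  edges e he := by
    rcases Finset.mem_insert.1 he with rfl | he
    · exact ⟨A, hA, B, hB, rfl, h⟩
    · exact hG.edges e he

/-- An undetermined pair of a consistent graph consists of two vertices of one class, so that it is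
merged by a query, or of two vertices of different classes, so that it becomes an edge. -/
theorem Consistent.cases_of_mem {ω : V → ι} {G : AggGraph V} (hG : Consistent ω G)
    {e : Sym2 (Finset V)} (he : e ∈ G.undetermined) :
    (∃ A ∈ G.verts, ∃ B ∈ G.verts, ∃ a, A ≠ B ∧ e = s(A, B) ∧ A.image ω = {a} ∧ B.image ω = {a} ∧
      answer ω e = true ∧ G.query ω e = G.merge s(A, B)) ∨
    (∃ A ∈ G.verts, ∃ B ∈ G.verts, ∃ a b, a ≠ b ∧ e = s(A, B) ∧ e ∉ G.edges ∧ A.image ω = {a} ∧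
      B.image ω = {b} ∧ answer ω e = false ∧ G.query ω e = G.addEdge s(A, B)) := by
  induction e using Sym2.ind with
  | _ A B =>
    obtain ⟨⟨hA, hB⟩, hAB, hE⟩ := mk_mem_undetermined.1 he
    obtain ⟨a, ha⟩ := hG.exists_image_eq A hA
    obtain ⟨b, hb⟩ := hG.exists_image_eq B hB
    have hans := answer_mk ha hb
    by_cases hab : a = b
    · subst hab
      left
      refine ⟨A, hA, B, hB, a, hAB, rfl, ha, hb, by simpa using hans, ?_⟩
      simp [query, hans]
    · right
      refine ⟨A, hA, B, hB, a, b, hab, rfl, hE, ha, hb, by simpa [hab] using hans, ?_⟩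
      simp [query, hans, hab]

theorem Consistent.query {ω : V → ι} {G : AggGraph V} (hG : Consistent ω G)
    {e : Sym2 (Finset V)} (he : e ∈ G.undetermined) : Consistent ω (G.query ω e) := by
  rcases hG.cases_of_mem he with ⟨A, hA, B, hB, a, hAB, rfl, ha, hb, -, hq⟩ |
    ⟨A, hA, B, hB, a, b, hab, rfl, -, ha, hb, -, hq⟩
  · rw [hq]
    exact consistent_merge hG hA hB ha hb
  · rw [hq]
    refine consistent_addEdge hG hA hB ?_
    rw [ha, hb]
    simpa using hab

theorem card_verts_merge {ω : V → ι} {G : AggGraph V} (hG : Consistent ω G) {A B : Finset V}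
    (hA : A ∈ G.verts) (hB : B ∈ G.verts) (hAB : A ≠ B) :
    (G.merge s(A, B)).verts.card + 1 = G.verts.card := by
  have h1 : B ∈ G.verts.erase A := Finset.mem_erase.2 ⟨hAB.symm, hB⟩
  rw [merge_verts, Finset.card_insert_of_notMem, Finset.card_erase_add_one h1,
    Finset.card_erase_add_one hA]
  exact fun h => hG.union_notMem hA hB hAB
    (Finset.mem_of_mem_erase (Finset.mem_of_mem_erase h))

theorem card_classVerts_merge {ω : V → ι} {G : AggGraph V} (hG : Consistent ω G) {A B : Finset V}
    {a : ι} (hA : A ∈ G.verts) (hB : B ∈ G.verts) (hAB : A ≠ B)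
    (ha : A.image ω = {a}) (hb : B.image ω = {a}) :
    (classVerts ω (G.merge s(A, B)) a).card + 1 = (classVerts ω G a).card := by
  have h0 : A ∈ classVerts ω G a := Finset.mem_filter.2 ⟨hA, ha⟩
  have h1 : B ∈ (classVerts ω G a).erase A :=
    Finset.mem_erase.2 ⟨hAB.symm, Finset.mem_filter.2 ⟨hB, hb⟩⟩
  have h2 : classVerts ω (G.merge s(A, B)) a =
      insert (A ∪ B) (((classVerts ω G a).erase A).erase B) := by
    rw [classVerts, merge_verts, Finset.filter_insert, if_pos (image_union_eq ha hb), classVerts]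
    congr 1
    ext C
    simp only [Finset.mem_filter, Finset.mem_erase]
    tauto
  rw [h2, Finset.card_insert_of_notMem, Finset.card_erase_add_one h1,
    Finset.card_erase_add_one h0]
  exact fun h => hG.union_notMem hA hB hAB (Finset.mem_of_mem_filter _
    (Finset.mem_of_mem_erase (Finset.mem_of_mem_erase h)))

theorem classVerts_merge_of_ne {ω : V → ι} {G : AggGraph V} {A B : Finset V}
    {a i : ι} (ha : A.image ω = {a}) (hb : B.image ω = {a}) (hi : i ≠ a) :
    classVerts ω (G.merge s(A, B)) i = classVerts ω G i := by
  rw [classVerts, merge_verts, Finset.filter_insert, if_neg, classVerts]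
  · ext C
    simp only [Finset.mem_filter, Finset.mem_erase]
    constructor
    · tauto
    · rintro ⟨h1, h2⟩
      refine ⟨⟨?_, ?_, h1⟩, h2⟩
      · rintro rfl
        exact hi (Finset.singleton_injective (h2.symm.trans hb))
      · rintro rfl
        exact hi (Finset.singleton_injective (h2.symm.trans ha))
  · rw [image_union_eq ha hb]
    simpa using Ne.symm hi

theorem isBetween_map {ω : V → ι} {A B : Finset V} {a i j : ι}
    (ha : A.image ω = {a}) (hb : B.image ω = {a}) (e : Sym2 (Finset V)) :
    IsBetween ω i j (e.map fun c => if c = A ∨ c = B then A ∪ B else c) ↔ IsBetween ω i j e := by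
  rw [IsBetween, IsBetween, Sym2.map_map]
  have : (Finset.image ω ∘ fun c => if c = A ∨ c = B then A ∪ B else c) = Finset.image ω :=
    funext fun c => image_relabel ha hb c
  rw [this]

theorem crossEdges_merge {ω : V → ι} {G : AggGraph V} {A B : Finset V} {a : ι}
    (ha : A.image ω = {a}) (hb : B.image ω = {a}) (i j : ι) :
    crossEdges ω (G.merge s(A, B)) i j = (crossEdges ω G i j).image
      (Sym2.map fun c => if c = A ∨ c = B then A ∪ B else c) := by
  rw [crossEdges, merge_edges, Finset.filter_image, crossEdges]
  simp only [isBetween_map ha hb]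

/-- Only an inequality holds: edges from the two merged vertices to a common neighbour coalesce. -/
theorem card_crossEdges_merge_le {ω : V → ι} {G : AggGraph V} {A B : Finset V} {a : ι}
    (ha : A.image ω = {a}) (hb : B.image ω = {a}) (i j : ι) :
    (crossEdges ω (G.merge s(A, B)) i j).card ≤ (crossEdges ω G i j).card := by
  rw [crossEdges_merge ha hb]
  exact Finset.card_image_le

theorem crossEdges_merge_of_ne {ω : V → ι} {G : AggGraph V} {A B : Finset V} {a i j : ι}
    (ha : A.image ω = {a}) (hb : B.image ω = {a}) (hi : i ≠ a) (hj : j ≠ a) :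
    crossEdges ω (G.merge s(A, B)) i j = crossEdges ω G i j := by
  rw [crossEdges_merge ha hb]
  conv_rhs => rw [← Finset.image_id (s := crossEdges ω G i j)]
  refine Finset.image_congr fun e he => ?_
  have he' := (Finset.mem_filter.1 he).2
  rw [IsBetween] at he'
  have key : ∀ c ∈ e, ¬ (c = A ∨ c = B) := by
    intro c hc h
    have h1 : c.image ω = {a} := by rcases h with rfl | rfl <;> assumption
    have h2 : c.image ω ∈ e.map (Finset.image ω) := Sym2.mem_map.2 ⟨c, hc, rfl⟩
    rw [he', Sym2.mem_iff, h1] at h2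
    simp only [Finset.singleton_inj] at h2
    rcases h2 with h2 | h2
    · exact hi h2.symm
    · exact hj h2.symm
  have h1 : e.map (fun c => if c = A ∨ c = B then A ∪ B else c) = e.map id :=
    Sym2.map_congr fun c hc => if_neg (key c hc)
  rw [h1, Sym2.map_id]

theorem crossEdges_addEdge_of_not {ω : V → ι} {G : AggGraph V} {e : Sym2 (Finset V)} {i j : ι}
    (h : ¬ IsBetween ω i j e) : crossEdges ω (G.addEdge e) i j = crossEdges ω G i j := by
  rw [crossEdges, addEdge, Finset.filter_insert, if_neg h, crossEdges]

theorem card_crossEdges_addEdge {ω : V → ι} {G : AggGraph V} {e : Sym2 (Finset V)} {i j : ι}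
    (he : e ∉ G.edges) (h : IsBetween ω i j e) :
    (crossEdges ω (G.addEdge e) i j).card = (crossEdges ω G i j).card + 1 := by
  rw [crossEdges, addEdge, Finset.filter_insert, if_pos h, Finset.card_insert_of_notMem, crossEdges]
  exact fun h' => he (Finset.mem_of_mem_filter _ h')

/-- Edges never join vertices of one class, so every pair inside a class is undetermined. -/
theorem card_openPairs_self {ω : V → ι} {G : AggGraph V} (hG : Consistent ω G) (i : ι) :
    (openPairs ω G i i).card = (classVerts ω G i).card.choose 2 := by
  rw [← Sym2.card_image_offDiag]
  congr 1
  ext e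
  induction e using Sym2.ind with
  | _ A B =>
    simp only [openPairs, Finset.mem_filter, mk_mem_undetermined, Finset.mem_image,
      Finset.mem_offDiag, Prod.exists]
    constructor
    · rintro ⟨⟨⟨hA, hB⟩, hAB, -⟩, h⟩
      obtain ⟨a, ha⟩ := hG.exists_image_eq A hA
      obtain ⟨b, hb⟩ := hG.exists_image_eq B hB
      rw [isBetween_mk_iff ha hb] at h
      have h1 : a = i ∧ b = i := by tauto
      rw [h1.1] at ha
      rw [h1.2] at hb
      exact ⟨A, B, ⟨Finset.mem_filter.2 ⟨hA, ha⟩, Finset.mem_filter.2 ⟨hB, hb⟩, hAB⟩, rfl⟩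
    · rintro ⟨C, D, ⟨hC, hD, hCD⟩, h⟩
      rw [← mk_mem_undetermined, ← show s(C, D) = s(A, B) from h]
      obtain ⟨hC, hc⟩ := Finset.mem_filter.1 hC
      obtain ⟨hD, hd⟩ := Finset.mem_filter.1 hD
      refine ⟨mk_mem_undetermined.2 ⟨⟨hC, hD⟩, hCD, fun he => ?_⟩, (isBetween_mk_iff hc hd).2 ?_⟩
      · obtain ⟨A', hA', B', hB', h', hne⟩ := hG.edges _ he
        rw [Sym2.eq_iff] at h'
        rcases h' with ⟨rfl, rfl⟩ | ⟨rfl, rfl⟩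
        · exact hne (hc.trans hd.symm)
        · exact hne (hd.trans hc.symm)
      · simp

theorem card_openPairs_add_card_crossEdges {ω : V → ι} {G : AggGraph V} (hG : Consistent ω G)
    {i j : ι} (hij : i ≠ j) :
    (openPairs ω G i j).card + (crossEdges ω G i j).card =
      (classVerts ω G i).card * (classVerts ω G j).card := by
  have hdisj : Disjoint (openPairs ω G i j) (crossEdges ω G i j) := by
    rw [Finset.disjoint_left]
    intro e he he'
    exact (Finset.mem_filter.1 (Finset.mem_filter.1 he).1).2.2 (Finset.mem_filter.1 he').1
  rw [← Finset.card_union_of_disjoint hdisj, ← Finset.card_product]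
  symm
  refine Finset.card_bij (fun x _ => s(x.1, x.2)) ?_ ?_ ?_
  · rintro ⟨A, B⟩ h
    obtain ⟨hA, hB⟩ := Finset.mem_product.1 h
    obtain ⟨hA, ha⟩ := Finset.mem_filter.1 hA
    obtain ⟨hB, hb⟩ := Finset.mem_filter.1 hB
    have hbt : IsBetween ω i j s(A, B) := (isBetween_mk_iff ha hb).2 (by simp)
    rw [Finset.mem_union]
    by_cases he : s(A, B) ∈ G.edges
    · exact Or.inr (Finset.mem_filter.2 ⟨he, hbt⟩)
    · refine Or.inl (Finset.mem_filter.2 ⟨mk_mem_undetermined.2 ⟨⟨hA, hB⟩, ?_, he⟩, hbt⟩)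
      intro hAB
      exact hij (Finset.singleton_injective (ha.symm.trans ((congrArg _ hAB).trans hb)))
  · rintro ⟨A, B⟩ h ⟨C, D⟩ h' heq
    obtain ⟨hA, hB⟩ := Finset.mem_product.1 h
    obtain ⟨hC, hD⟩ := Finset.mem_product.1 h'
    rcases Sym2.eq_iff.1 heq with ⟨h1, h2⟩ | ⟨h1, h2⟩
    · exact Prod.ext h1 h2
    · exfalso
      dsimp only at h1 h2
      subst h1
      exact hij (Finset.singleton_injective
        ((Finset.mem_filter.1 hA).2.symm.trans (Finset.mem_filter.1 hD).2))
  · intro e he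
    have key : ∃ A ∈ G.verts, ∃ B ∈ G.verts, e = s(A, B) ∧ IsBetween ω i j e := by
      rcases Finset.mem_union.1 he with he | he
      · obtain ⟨h1, h2⟩ := Finset.mem_filter.1 he
        induction e using Sym2.ind with
        | _ A B =>
          obtain ⟨⟨hA, hB⟩, -⟩ := mk_mem_undetermined.1 h1
          exact ⟨A, hA, B, hB, rfl, h2⟩
      · obtain ⟨h1, h2⟩ := Finset.mem_filter.1 he
        obtain ⟨A, hA, B, hB, h3, -⟩ := hG.edges e h1
        exact ⟨A, hA, B, hB, h3, h2⟩
    obtain ⟨A, hA, B, hB, rfl, hbt⟩ := key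
    obtain ⟨a, ha⟩ := hG.exists_image_eq A hA
    obtain ⟨b, hb⟩ := hG.exists_image_eq B hB
    rcases (isBetween_mk_iff ha hb).1 hbt with ⟨rfl, rfl⟩ | ⟨rfl, rfl⟩
    · exact ⟨(A, B), Finset.mem_product.2
        ⟨Finset.mem_filter.2 ⟨hA, ha⟩, Finset.mem_filter.2 ⟨hB, hb⟩⟩, rfl⟩
    · exact ⟨(B, A), Finset.mem_product.2
        ⟨Finset.mem_filter.2 ⟨hB, hb⟩, Finset.mem_filter.2 ⟨hA, ha⟩⟩, Sym2.eq_swap⟩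

/-- A lower bound for the total decrease, over all possible queries, of a function of the numbers of
vertices of two classes and of the number of edges between them. -/
theorem le_sum_sub_query {ω : V → ι} {G : AggGraph V} (hG : Consistent ω G) {i j : ι} (hij : i ≠ j)
    (Φ : ℕ → ℕ → ℕ → ℝ) {a b m : ℕ} (ha : (classVerts ω G i).card = a)
    (hb : (classVerts ω G j).card = b) (hm : (crossEdges ω G i j).card = m) {x y : ℝ}
    (hx : 2 ≤ a → ∀ m' ≤ m, x ≤ Φ a b m - Φ (a - 1) b m')
    (hy : 2 ≤ b → ∀ m' ≤ m, y ≤ Φ a b m - Φ a (b - 1) m') :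
    a.choose 2 * x + b.choose 2 * y + (a * b - m) * (Φ a b m - Φ a b (m + 1)) ≤
      ∑ e ∈ G.undetermined, (Φ a b m - Φ (classVerts ω (G.query ω e) i).card
        (classVerts ω (G.query ω e) j).card (crossEdges ω (G.query ω e) i j).card) := by
  have h1 : (a.choose 2 : ℝ) = (openPairs ω G i i).card := by
    rw [card_openPairs_self hG, ha]
  have h2 : (b.choose 2 : ℝ) = (openPairs ω G j j).card := by
    rw [card_openPairs_self hG, hb]
  have h3 : (a * b - m : ℝ) = (openPairs ω G i j).card := by
    have := card_openPairs_add_card_crossEdges hG hij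
    rw [ha, hb, hm] at this
    have h' : ((openPairs ω G i j).card : ℝ) + m = a * b := by exact_mod_cast this
    linarith
  -- The three counts become one sum of indicators over the undetermined pairs, to be compared term
  -- by term.
  rw [h1, h2, h3, openPairs, openPairs, openPairs, ← nsmul_eq_mul, ← nsmul_eq_mul, ← nsmul_eq_mul,
    ← Finset.sum_const, ← Finset.sum_const, ← Finset.sum_const, Finset.sum_filter,
    Finset.sum_filter, Finset.sum_filter, ← Finset.sum_add_distrib, ← Finset.sum_add_distrib]
  refine Finset.sum_le_sum fun e he => ?_
  rcases hG.cases_of_mem he with ⟨A, hA, B, hB, c, hAB, rfl, hAc, hBc, -, hq⟩ |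
    ⟨A, hA, B, hB, c, d, hcd, rfl, hE, hAc, hBd, -, hq⟩
  · rw [hq]
    simp only [isBetween_mk_iff hAc hBc]
    have hle := card_crossEdges_merge_le (G := G) hAc hBc i j
    -- The merged class had two vertices, which is what `hx` and `hy` require.
    have hcard : 2 ≤ (classVerts ω G c).card := by
      have : ({A, B} : Finset (Finset V)) ⊆ classVerts ω G c := by
        intro C hC
        rcases Finset.mem_insert.1 hC with rfl | hC
        · exact Finset.mem_filter.2 ⟨hA, hAc⟩
        · rw [Finset.mem_singleton.1 hC]
          exact Finset.mem_filter.2 ⟨hB, hBc⟩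
      have := Finset.card_le_card this
      rwa [Finset.card_pair hAB] at this
    by_cases hci : c = i
    · subst hci
      have h4 := card_classVerts_merge hG hA hB hAB hAc hBc
      rw [classVerts_merge_of_ne hAc hBc hij.symm, hb]
      have h5 : (classVerts ω (G.merge s(A, B)) c).card = a - 1 := by omega
      rw [h5]
      simpa [hij] using hx (ha ▸ hcard) _ (hm ▸ hle)
    · by_cases hcj : c = j
      · subst hcj
        have h4 := card_classVerts_merge hG hA hB hAB hAc hBc
        rw [classVerts_merge_of_ne hAc hBc hij, ha]
        have h5 : (classVerts ω (G.merge s(A, B)) c).card = b - 1 := by omega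
        rw [h5]
        simpa [hci] using hy (hb ▸ hcard) _ (hm ▸ hle)
      · rw [classVerts_merge_of_ne hAc hBc (Ne.symm hci), classVerts_merge_of_ne hAc hBc
          (Ne.symm hcj), crossEdges_merge_of_ne hAc hBc (Ne.symm hci) (Ne.symm hcj), ha, hb, hm]
        simp [hci, hcj]
  · rw [hq]
    have e1 : classVerts ω (G.addEdge s(A, B)) i = classVerts ω G i := rfl
    have e2 : classVerts ω (G.addEdge s(A, B)) j = classVerts ω G j := rfl
    have n1 : ¬ IsBetween ω i i s(A, B) := by
      rw [isBetween_mk_iff hAc hBd]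
      rintro (⟨rfl, rfl⟩ | ⟨rfl, rfl⟩) <;> exact hcd rfl
    have n2 : ¬ IsBetween ω j j s(A, B) := by
      rw [isBetween_mk_iff hAc hBd]
      rintro (⟨rfl, rfl⟩ | ⟨rfl, rfl⟩) <;> exact hcd rfl
    rw [e1, e2, ha, hb, if_neg n1, if_neg n2]
    by_cases h : IsBetween ω i j s(A, B)
    · rw [card_crossEdges_addEdge hE h, hm, if_pos h]
      simp
    · rw [crossEdges_addEdge_of_not h, hm, if_neg h]
      simp

end AggGraph

/-! ### Expected costs as a recursion, and the potential method -/

theorem PMF.tsum_bind_mul {α β : Type} (p : PMF α) (f : α → PMF β) (X : β → ℝ≥0∞) :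
    ∑' b, p.bind f b * X b = ∑' a, p a * ∑' b, f a b * X b := by
  simp only [PMF.bind_apply, ← ENNReal.tsum_mul_right, ← ENNReal.tsum_mul_left]
  rw [ENNReal.tsum_comm]
  simp only [mul_assoc]

theorem PMF.tsum_map_mul {α β : Type} (p : PMF α) (g : α → β) (X : β → ℝ≥0∞) :
    ∑' b, p.map g b * X b = ∑' a, p a * X (g a) := by
  rw [PMF.map, PMF.tsum_bind_mul]
  refine tsum_congr fun a => ?_
  rw [tsum_eq_single (g a)]
  · simp
  · intro b hb
    simp [hb]

namespace AggGraph

variable {V ι : Type} [DecidableEq ι] [DecidableEq V]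

/-- The expected total cost of the queries made by the random algorithm from the graph `G` on, where
a query that is answered by `b` costs `c b`. -/
noncomputable def meanCost (ω : V → ι) (c : Bool → ℝ) (G : AggGraph V) : ℝ :=
  if G.undetermined.Nonempty then
    (∑ e : G.undetermined, (c (answer ω e.1) + meanCost ω c (G.query ω e.1))) /
      G.undetermined.card
  else 0
termination_by (G.verts.card, G.undetermined.card)
decreasing_by
  unfold query
  split
  · exact Prod.Lex.left _ _ (G.card_verts_merge_lt e.2)
  · exact Prod.Lex.right _ (G.card_undetermined_addEdge_lt e.2)

theorem meanCost_of_not_nonempty {ω : V → ι} {c : Bool → ℝ} {G : AggGraph V}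
    (h : ¬ G.undetermined.Nonempty) : meanCost ω c G = 0 := by
  rw [meanCost, if_neg h]

theorem meanCost_of_nonempty {ω : V → ι} {c : Bool → ℝ} {G : AggGraph V}
    (h : G.undetermined.Nonempty) : meanCost ω c G =
      (∑ e ∈ G.undetermined, (c (answer ω e) + meanCost ω c (G.query ω e))) /
        G.undetermined.card := by
  rw [meanCost, if_pos h, ← Finset.sum_coe_sort G.undetermined]

/-- Induction along the runs of the algorithm. -/
theorem query_induction (ω : V → ι) {P : AggGraph V → Prop}
    (h : ∀ G : AggGraph V, (∀ e ∈ G.undetermined, P (G.query ω e)) → P G) (G : AggGraph V) :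
    P G := by
  induction G using meanCost.induct (ω := ω) with
  | case1 G _ ih => exact h G fun e he => ih ⟨e, he⟩
  | case2 G hG => exact h G fun e he => absurd ⟨e, he⟩ hG

theorem meanCost_nonneg {ω : V → ι} {c : Bool → ℝ} (hc : ∀ b, 0 ≤ c b) (G : AggGraph V) :
    0 ≤ meanCost ω c G := by
  induction G using query_induction ω with
  | h G ih =>
    by_cases hG : G.undetermined.Nonempty
    · rw [meanCost_of_nonempty hG]
      exact div_nonneg (Finset.sum_nonneg fun e he => add_nonneg (hc _) (ih e he))
        (Nat.cast_nonneg _)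
    · rw [meanCost_of_not_nonempty hG]

/-- With signed costs allowed, the upper bound `meanCost_le` also yields lower bounds. -/
theorem meanCost_neg (ω : V → ι) (c : Bool → ℝ) (G : AggGraph V) :
    meanCost ω (fun b => -c b) G = -meanCost ω c G := by
  induction G using query_induction ω with
  | h G ih =>
    by_cases hG : G.undetermined.Nonempty
    · rw [meanCost_of_nonempty hG, meanCost_of_nonempty hG, ← neg_div, ← Finset.sum_neg_distrib]
      congr 1
      refine Finset.sum_congr rfl fun e he => ?_
      rw [ih e he]
      ring
    · rw [meanCost_of_not_nonempty hG, meanCost_of_not_nonempty hG, neg_zero]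

theorem meanCost_add (ω : V → ι) (c d : Bool → ℝ) (G : AggGraph V) :
    meanCost ω (fun b => c b + d b) G = meanCost ω c G + meanCost ω d G := by
  induction G using query_induction ω with
  | h G ih =>
    by_cases hG : G.undetermined.Nonempty
    · rw [meanCost_of_nonempty hG, meanCost_of_nonempty hG, meanCost_of_nonempty hG, ← add_div,
        ← Finset.sum_add_distrib]
      congr 1
      refine Finset.sum_congr rfl fun e he => ?_
      rw [ih e he]
      ring
    · simp only [meanCost_of_not_nonempty hG, add_zero]

/-- A function of the graph whose expected decrease at each query is at least the expected cost of
the query is an upper bound for the expected total cost. -/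
theorem meanCost_le {ω : V → ι} {c : Bool → ℝ} (Ψ : AggGraph V → ℝ)
    (hΨ : ∀ G, Consistent ω G →
      ∑ e ∈ G.undetermined, c (answer ω e) ≤ ∑ e ∈ G.undetermined, (Ψ G - Ψ (G.query ω e)))
    (h0 : ∀ G, Consistent ω G → G.undetermined = ∅ → 0 ≤ Ψ G) (G : AggGraph V)
    (hG : Consistent ω G) : meanCost ω c G ≤ Ψ G := by
  induction G using query_induction ω with
  | h G ih =>
    by_cases hU : G.undetermined.Nonempty
    · have hpos : (0 : ℝ) < G.undetermined.card := by exact_mod_cast hU.card_pos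
      -- The choice is uniform, so the hypothesis on unnormalised sums is all that is needed.
      rw [meanCost_of_nonempty hU, div_le_iff₀ hpos, Finset.sum_add_distrib]
      have h1 := hΨ G hG
      have h2 : ∑ e ∈ G.undetermined, meanCost ω c (G.query ω e) ≤
          ∑ e ∈ G.undetermined, Ψ (G.query ω e) :=
        Finset.sum_le_sum fun e he => ih e he (hG.query he)
      rw [Finset.sum_sub_distrib, Finset.sum_const, nsmul_eq_mul] at h1
      linarith
    · rw [meanCost_of_not_nonempty hU]
      exact h0 G hG (Finset.not_nonempty_iff_eq_empty.1 hU)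

/-- This passes from the law of the answer list to the real recursion, for statistics that are
additive along the list. -/
theorem tsum_randomRun_mul (ω : V → ι) (w : Bool → ℕ) (X : List Bool → ℕ) (hX0 : X [] = 0)
    (hX : ∀ b l, X (b :: l) = w b + X l) (G : AggGraph V) :
    ∑' l, randomRun ω G l * (X l : ℝ≥0∞) = ENNReal.ofReal (meanCost ω (fun b => (w b : ℝ)) G) := by
  have hw : ∀ b, (0 : ℝ) ≤ (w b : ℝ) := fun b => Nat.cast_nonneg _
  induction G using query_induction ω with
  | h G ih =>
    by_cases hG : G.undetermined.Nonempty
    · have hcard : (0 : ℝ) < G.undetermined.card := by exact_mod_cast hG.card_pos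
      have : Nonempty G.undetermined := hG.to_subtype
      rw [randomRun, dif_pos hG, PMF.tsum_bind_mul, tsum_fintype, meanCost_of_nonempty hG,
        ENNReal.ofReal_div_of_pos hcard, ENNReal.ofReal_natCast,
        ENNReal.ofReal_sum_of_nonneg fun e _ => add_nonneg (hw _) (meanCost_nonneg hw _),
        ← Finset.sum_coe_sort G.undetermined, div_eq_mul_inv, mul_comm, Finset.mul_sum]
      refine Finset.sum_congr rfl fun e _ => ?_
      rw [PMF.tsum_map_mul, PMF.uniformOfFintype_apply, Fintype.card_coe,
        ENNReal.ofReal_add (hw _) (meanCost_nonneg hw _), ENNReal.ofReal_natCast,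
        ← ih e.1 e.2]
      simp only [hX, Nat.cast_add, mul_add]
      rw [ENNReal.tsum_add, ENNReal.tsum_mul_right, PMF.tsum_coe, one_mul, mul_add]
    · rw [randomRun, dif_neg hG, meanCost_of_not_nonempty hG, tsum_eq_single []]
      · simp [hX0]
      · intro l hl
        simp [hl]

section Initial

variable [Fintype V]

theorem consistent_initial (ω : V → ι) : Consistent ω (initial V) where
  exists_image_eq B hB := by
    obtain ⟨v, -, rfl⟩ := Finset.mem_image.1 hB
    exact ⟨ω v, Finset.image_singleton ω v⟩
  disjoint A hA B hB hAB := by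
    obtain ⟨u, -, rfl⟩ := Finset.mem_image.1 hA
    obtain ⟨v, -, rfl⟩ := Finset.mem_image.1 hB
    simpa using hAB
  edges e he := by simp [initial] at he

theorem card_verts_initial : (initial V).verts.card = Fintype.card V := by
  rw [initial, Finset.card_image_of_injective _ Finset.singleton_injective, Finset.card_univ]

theorem card_classVerts_initial (ω : V → ι) (i : ι) :
    (classVerts ω (initial V) i).card = (Finset.univ.filter fun v => ω v = i).card := by
  rw [classVerts, initial, Finset.filter_image,
    Finset.card_image_of_injective _ Finset.singleton_injective]
  simp

theorem crossEdges_initial (ω : V → ι) (i j : ι) : crossEdges ω (initial V) i j = ∅ := rfl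

end Initial

/-! ### Counting the positive answers -/

/-- The number of queries with a positive answer: it is at most the number of vertices. -/
theorem meanCost_true_le {ω : V → ι} {G : AggGraph V} (hG : Consistent ω G) :
    meanCost ω (fun b => if b = true then 1 else 0) G ≤ G.verts.card := by
  refine meanCost_le (fun G => (G.verts.card : ℝ)) (fun G hG => ?_)
    (fun G _ _ => Nat.cast_nonneg _) G hG
  refine Finset.sum_le_sum fun e he => ?_
  rcases hG.cases_of_mem he with ⟨A, hA, B, hB, a, hAB, rfl, -, -, hans, hq⟩ |
    ⟨A, hA, B, hB, a, b, -, rfl, -, -, -, hans, hq⟩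
  · have := card_verts_merge hG hA hB hAB
    rw [hans, hq, ← this]
    simp
  · rw [hans, hq]
    simp [addEdge]

/-- All pairs inside a class are undetermined, so none may exist at the end. -/
theorem card_classVerts_le_one {ω : V → ι} {G : AggGraph V} (hG : Consistent ω G)
    (hU : G.undetermined = ∅) (i : ι) : (classVerts ω G i).card ≤ 1 := by
  have h := card_openPairs_self hG i
  rw [openPairs, hU, Finset.filter_empty, Finset.card_empty, eq_comm, Nat.choose_eq_zero_iff] at h
  omega

theorem card_verts_le [Fintype ι] {ω : V → ι} {G : AggGraph V} (hG : Consistent ω G)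
    (hU : G.undetermined = ∅) : G.verts.card ≤ Fintype.card ι := by
  calc G.verts.card ≤ (Finset.univ.biUnion fun i => classVerts ω G i).card := by
        refine Finset.card_le_card fun B hB => ?_
        obtain ⟨i, hi⟩ := hG.exists_image_eq B hB
        exact Finset.mem_biUnion.2 ⟨i, Finset.mem_univ i, Finset.mem_filter.2 ⟨hB, hi⟩⟩
    _ ≤ Finset.univ.card * 1 :=
        Finset.card_biUnion_le_card_mul _ _ _ fun i _ => card_classVerts_le_one hG hU i
    _ = Fintype.card ι := by rw [mul_one, Finset.card_univ]

/-- The number of vertices falls by one at each positive answer and ends at most at the number of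
classes. -/
theorem le_meanCost_true [Fintype ι] {ω : V → ι} {G : AggGraph V} (hG : Consistent ω G) :
    (G.verts.card - Fintype.card ι : ℝ) ≤ meanCost ω (fun b => if b = true then 1 else 0) G := by
  suffices meanCost ω (fun b => -(if b = true then 1 else 0)) G ≤
      (Fintype.card ι - G.verts.card : ℝ) by
    rw [meanCost_neg] at this
    linarith
  refine meanCost_le (fun G => (Fintype.card ι - G.verts.card : ℝ)) (fun G hG => ?_)
    (fun G hG hU => ?_) G hG
  · refine Finset.sum_le_sum fun e he => ?_
    rcases hG.cases_of_mem he with ⟨A, hA, B, hB, a, hAB, rfl, -, -, hans, hq⟩ |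
      ⟨A, hA, B, hB, a, b, -, rfl, -, -, -, hans, hq⟩
    · have := card_verts_merge hG hA hB hAB
      rw [hans, hq, ← this]
      simp
    · rw [hans, hq]
      simp [addEdge]
  · have : (G.verts.card : ℝ) ≤ Fintype.card ι := by exact_mod_cast card_verts_le hG hU
    linarith

/-! ### Potentials for the negative answers -/

theorem meanCost_false_of_const {ω : V → ι} (hω : ∀ u v, ω u = ω v) {G : AggGraph V}
    (hG : Consistent ω G) : meanCost ω (fun b => if b = false then 1 else 0) G = 0 := by
  refine le_antisymm (meanCost_le (fun _ => 0) (fun G _ => ?_) (fun _ _ _ => le_rfl) G hG)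
    (meanCost_nonneg (fun b => by split_ifs <;> norm_num) G)
  refine Finset.sum_le_sum fun e _ => ?_
  have : answer ω e = true := decide_eq_true fun u _ v _ => hω u v
  simp [this]

/-- A pair with a negative answer lies between exactly one pair of classes i < j, which splits the
cost into contributions matching `pairSum`. -/
theorem sum_answer_false {k : ℕ} {ω : V → Fin k} {G : AggGraph V} (hG : Consistent ω G) :
    ∑ e ∈ G.undetermined, (if answer ω e = false then (1 : ℝ) else 0) =
      ∑ i, ∑ j ∈ Finset.Ioi i, ((openPairs ω G i j).card : ℝ) := by
  have key : ∀ e ∈ G.undetermined, (if answer ω e = false then (1 : ℝ) else 0) =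
      ∑ i, ∑ j ∈ Finset.Ioi i, if IsBetween ω i j e then 1 else 0 := by
    intro e he
    rcases hG.cases_of_mem he with ⟨A, -, B, -, a, -, rfl, hAa, hBa, hans, -⟩ |
      ⟨A, -, B, -, a, b, hab, rfl, -, hAa, hBb, hans, -⟩
    · rw [hans, if_neg (by simp)]
      symm
      refine Finset.sum_eq_zero fun i _ => Finset.sum_eq_zero fun j hj => if_neg ?_
      rw [isBetween_mk_iff hAa hBa]
      have := (Finset.mem_Ioi.1 hj).ne
      rintro (⟨rfl, rfl⟩ | ⟨rfl, rfl⟩) <;> exact this rfl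
    · rw [hans, if_pos rfl]
      wlog hlt : a < b generalizing A B a b
      · rw [Sym2.eq_swap]
        exact this B A b a hab.symm (Sym2.eq_swap ▸ he) hBb hAa (Sym2.eq_swap ▸ hans)
          (lt_of_le_of_ne (not_lt.1 hlt) hab.symm)
      symm
      rw [Finset.sum_eq_single a, Finset.sum_eq_single b]
      · rw [if_pos ((isBetween_mk_iff hAa hBb).2 (by simp))]
      · intro j hj hjb
        refine if_neg ?_
        rw [isBetween_mk_iff hAa hBb]
        rintro (⟨-, rfl⟩ | ⟨rfl, h⟩)
        · exact hjb rfl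
        · exact hab h.symm
      · intro h
        exact absurd (Finset.mem_Ioi.2 hlt) h
      · intro i _ hia
        refine Finset.sum_eq_zero fun j hj => if_neg ?_
        rw [isBetween_mk_iff hAa hBb]
        rintro (⟨rfl, -⟩ | ⟨rfl, rfl⟩)
        · exact hia rfl
        · exact absurd (Finset.mem_Ioi.1 hj) hlt.not_gt
      · simp
  rw [Finset.sum_congr rfl key, Finset.sum_comm]
  refine Finset.sum_congr rfl fun i _ => ?_
  rw [Finset.sum_comm]
  refine Finset.sum_congr rfl fun j _ => ?_
  rw [Finset.sum_boole, openPairs]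

theorem cast_card_openPairs {ω : V → ι} {G : AggGraph V} (hG : Consistent ω G) {i j : ι}
    (hij : i ≠ j) : ((openPairs ω G i j).card : ℝ) =
      (classVerts ω G i).card * (classVerts ω G j).card - (crossEdges ω G i j).card := by
  have := card_openPairs_add_card_crossEdges hG hij
  have h' : ((openPairs ω G i j).card : ℝ) + (crossEdges ω G i j).card =
    (classVerts ω G i).card * (classVerts ω G j).card := by exact_mod_cast this
  linarith

/-- The sum over the pairs of classes of a function of the numbers of vertices of the two classes
and of the number of edges between them. -/
noncomputable def pairSum {k : ℕ} (ω : V → Fin k) (Φ : ℕ → ℕ → ℕ → ℝ) (G : AggGraph V) : ℝ :=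
  ∑ i, ∑ j ∈ Finset.Ioi i,
    Φ (classVerts ω G i).card (classVerts ω G j).card (crossEdges ω G i j).card

theorem sum_pairSum_sub {k : ℕ} (ω : V → Fin k) (Φ : ℕ → ℕ → ℕ → ℝ) (G : AggGraph V) :
    ∑ e ∈ G.undetermined, (pairSum ω Φ G - pairSum ω Φ (G.query ω e)) =
      ∑ i, ∑ j ∈ Finset.Ioi i, ∑ e ∈ G.undetermined,
        (Φ (classVerts ω G i).card (classVerts ω G j).card (crossEdges ω G i j).card -
          Φ (classVerts ω (G.query ω e) i).card (classVerts ω (G.query ω e) j).card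
            (crossEdges ω (G.query ω e) i j).card) := by
  simp only [pairSum, ← Finset.sum_sub_distrib]
  rw [Finset.sum_comm]
  refine Finset.sum_congr rfl fun i _ => ?_
  rw [Finset.sum_comm]

/-- A potential for an upper bound of the number of queries between two classes. -/
noncomputable def upperPotential (a b m : ℕ) : ℝ :=
  crossBound a b + if a = 1 ∧ b = 1 then 1 - (m : ℝ) else 1

/-- While a merge is possible, the drop of `crossBound` is at least a * b, more than the a * b - m
costly queries. At a = b = 1 no merge is possible and only the term 1 - m, the number of queries
left, can decrease. -/
theorem meanCost_false_le {k : ℕ} {ω : V → Fin k} {G : AggGraph V} (hG : Consistent ω G) :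
    meanCost ω (fun b => if b = false then 1 else 0) G ≤ pairSum ω upperPotential G := by
  refine meanCost_le (pairSum ω upperPotential) (fun G hG => ?_) (fun G hG _ => ?_) G hG
  · rw [sum_answer_false hG, sum_pairSum_sub]
    refine Finset.sum_le_sum fun i _ => Finset.sum_le_sum fun j hj => ?_
    have hij : i ≠ j := (Finset.mem_Ioi.1 hj).ne
    rw [cast_card_openPairs hG hij]
    obtain ⟨a, ha⟩ : ∃ a, (classVerts ω G i).card = a := ⟨_, rfl⟩
    obtain ⟨b, hb⟩ : ∃ b, (classVerts ω G j).card = b := ⟨_, rfl⟩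
    obtain ⟨m, hm⟩ : ∃ m, (crossEdges ω G i j).card = m := ⟨_, rfl⟩
    have hle : ∀ (a b m : ℕ), upperPotential a b m ≤ crossBound a b + 1 := by
      intro a b m
      unfold upperPotential
      split_ifs
      · have : (0 : ℝ) ≤ m := Nat.cast_nonneg _
        linarith
      · exact le_rfl
    have key := le_sum_sub_query hG hij upperPotential ha hb hm
      (x := crossBound a b - crossBound (a - 1) b) (y := crossBound a b - crossBound a (b - 1))
      -- A merge may lead to a = b = 1, where the last term is 1 - m' instead of 1; this only
      -- increases the drop.
      (fun h2 m' _ => by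
        have := hle (a - 1) b m'
        rw [upperPotential, if_neg (by omega)]
        linarith)
      (fun h2 m' _ => by
        have := hle a (b - 1) m'
        rw [upperPotential, if_neg (by omega)]
        linarith)
    rw [ha, hb, hm]
    refine le_trans ?_ key
    by_cases h : a = 1 ∧ b = 1
    · obtain ⟨rfl, rfl⟩ := h
      simp [upperPotential]
    · have h1 := mul_le_pairDrop_crossBound h
      have h2 : (0 : ℝ) ≤ m := Nat.cast_nonneg _
      simp only [upperPotential, if_neg h]
      rw [pairDrop] at h1
      linarith
  · refine Finset.sum_nonneg fun i _ => Finset.sum_nonneg fun j hj => ?_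
    have hij : i ≠ j := (Finset.mem_Ioi.1 hj).ne
    have h1 := cast_card_openPairs hG hij
    have h2 : (0 : ℝ) ≤ (openPairs ω G i j).card := Nat.cast_nonneg _
    have h3 := crossBound_nonneg (classVerts ω G i).card (classVerts ω G j).card
    unfold upperPotential
    split_ifs with h
    -- Here 1 - m is the number of open pairs, hence nonnegative.
    · rw [h.1, h.2] at h1 h3
      rw [h.1, h.2]
      push_cast at h1
      linarith
    · linarith

/-- A bound for the effect that the edges between two classes have on the number of queries between
them. -/
noncomputable def edgeCorrection (M a b m : ℕ) : ℝ :=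
  m * (2 / M - 2 / max (a : ℝ) M) + 2 / M * crossBound a b + crossBound (min a M) b

theorem edgeCorrection_nonneg {M : ℕ} (hM : 1 ≤ M) (a b m : ℕ) : 0 ≤ edgeCorrection M a b m := by
  have hM' : (0 : ℝ) < M := by exact_mod_cast hM
  have h1 : (2 : ℝ) / max (a : ℝ) M ≤ 2 / M := by
    gcongr
    exact le_max_right _ _
  have h2 := crossBound_nonneg a b
  have h3 := crossBound_nonneg (min a M) b
  have h4 := sub_nonneg.2 h1
  unfold edgeCorrection
  positivity

/-- A potential for a lower bound of the number of queries between two classes: minus the potential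
is such a bound. -/
noncomputable def lowerPotential (M a b m : ℕ) : ℝ :=
  edgeCorrection M a b m + 2 - crossRate a b

/-- In `edgeCorrection`, 2/M - 2/a is the expected time, at rate 1 per pair, in which a > M vertices
merge down to M. The first term charges each present edge for that time, the second prepays the
charge for edges still to come, and the third covers every cross hit after M is reached. -/
theorem neg_le_pairDrop_sum {M a b m : ℕ} (hM : 1 ≤ M) (hm : m ≤ a * b) :
    -(a * b - m : ℝ) ≤
      m * (a.choose 2 * ((2 / M - 2 / max (a : ℝ) M) - (2 / M - 2 / max ((a - 1 : ℕ) : ℝ) M)))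
        + 2 / M * pairDrop crossBound a b + pairDrop (fun a b => crossBound (min a M) b) a b
        - pairDrop (fun a b => crossRate a b) a b
        - (a * b - m) * (2 / M - 2 / max (a : ℝ) M) := by
  have hM' : (1 : ℝ) ≤ M := by exact_mod_cast hM
  have hm' : (m : ℝ) ≤ a * b := by exact_mod_cast hm
  have hm0 : (0 : ℝ) ≤ m := Nat.cast_nonneg _
  have h1 := pairDrop_nonneg (fun a b a' b' => crossBound_mono) a b
  have h2 : 0 ≤ pairDrop (fun a b => crossBound (min a M) b) a b :=
    pairDrop_nonneg (fun a b a' b' ha hb => crossBound_mono (by omega) hb) a b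
  have h3 := pairDrop_crossRate_le a b
  have h4 : 0 ≤ 2 / (M : ℝ) * pairDrop crossBound a b := by positivity
  rcases le_or_gt a M with ha | ha
  -- Below M the edge charge is zero, and the third term alone drops by at least the drop of
  -- `crossRate`.
  · have e1 : max (a : ℝ) M = M := max_eq_right (by exact_mod_cast ha)
    have e2 : max ((a - 1 : ℕ) : ℝ) M = M :=
      max_eq_right (by exact_mod_cast (Nat.sub_le a 1).trans ha)
    have e3 : pairDrop (fun a b => crossBound (min a M) b) a b = pairDrop crossBound a b := by
      simp only [pairDrop]
      rw [min_eq_left ha, min_eq_left ((Nat.sub_le a 1).trans ha)]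
    rw [e1, e2, e3]
    by_cases hab : a = 1 ∧ b = 1
    · have h5 : pairDrop (fun a b => crossRate a b) a b = 0 := by
        obtain ⟨rfl, rfl⟩ := hab
        simp [pairDrop]
      rw [h5]
      linarith
    · have h5 := mul_le_pairDrop_crossBound hab
      linarith
  · have ha' : (M : ℝ) < a := by exact_mod_cast ha
    have ha1 : (M : ℝ) ≤ a - 1 := by
      have : (M : ℝ) + 1 ≤ a := by exact_mod_cast ha
      linarith
    have e0 : ((a - 1 : ℕ) : ℝ) = a - 1 := by
      rw [Nat.cast_sub (by omega), Nat.cast_one]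
    have e1 : max (a : ℝ) M = a := max_eq_left ha'.le
    have e2 : max ((a - 1 : ℕ) : ℝ) M = a - 1 := by rw [e0, max_eq_left ha1]
    -- A merge from a to a - 1 takes expected time 1 / `a.choose 2`, so the charges of the m edges
    -- decrease by m in total: the missing hits.
    have e3 : (a.choose 2 : ℝ) * ((2 / M - 2 / a) - (2 / M - 2 / (a - 1))) = 1 := by
      have : (a : ℝ) - 1 ≠ 0 := by linarith
      have : (a : ℝ) ≠ 0 := by linarith
      rw [Nat.cast_choose_two]
      field_simp
      ring
    rw [e1, e2, e3]
    have h5 := mul_le_pairDrop_crossBound (show ¬ (a = 1 ∧ b = 1) by omega)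
    -- New edges raise the first term by at most 2/M each; the second term pays for this.
    have h6 : (a * b - m) * (2 / M - 2 / a) ≤ 2 / M * pairDrop crossBound a b := by
      have h7 : (2 : ℝ) / M - 2 / a ≤ 2 / M := by
        have : (0 : ℝ) ≤ 2 / a := by positivity
        linarith
      calc (a * b - m) * (2 / M - 2 / a) ≤ (a * b - m) * (2 / (M : ℝ)) := by
            apply mul_le_mul_of_nonneg_left h7
            linarith
        _ ≤ pairDrop crossBound a b * (2 / (M : ℝ)) := by
            gcongr
            linarith
        _ = _ := mul_comm _ _
    linarith

theorem neg_meanCost_false_le {k M : ℕ} (hM : 1 ≤ M) {ω : V → Fin k} {G : AggGraph V}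
    (hG : Consistent ω G) :
    -meanCost ω (fun b => if b = false then 1 else 0) G ≤ pairSum ω (lowerPotential M) G := by
  rw [← meanCost_neg]
  refine meanCost_le (pairSum ω (lowerPotential M)) (fun G hG => ?_) (fun G hG hU => ?_) G hG
  · rw [Finset.sum_neg_distrib, sum_answer_false hG, sum_pairSum_sub, ← Finset.sum_neg_distrib]
    refine Finset.sum_le_sum fun i _ => ?_
    rw [← Finset.sum_neg_distrib]
    refine Finset.sum_le_sum fun j hj => ?_
    have hij : i ≠ j := (Finset.mem_Ioi.1 hj).ne
    have hcard := card_openPairs_add_card_crossEdges hG hij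
    rw [cast_card_openPairs hG hij]
    obtain ⟨a, ha⟩ : ∃ a, (classVerts ω G i).card = a := ⟨_, rfl⟩
    obtain ⟨b, hb⟩ : ∃ b, (classVerts ω G j).card = b := ⟨_, rfl⟩
    obtain ⟨m, hm⟩ : ∃ m, (crossEdges ω G i j).card = m := ⟨_, rfl⟩
    rw [ha, hb, hm] at hcard
    -- The charge per edge is nonnegative, so a merge that coalesces edges can be treated as keeping
    -- all m of them.
    have hφ : ∀ a : ℕ, (0 : ℝ) ≤ 2 / M - 2 / max (a : ℝ) M := by
      intro a
      have hM' : (0 : ℝ) < M := by exact_mod_cast hM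
      have : (2 : ℝ) / max (a : ℝ) M ≤ 2 / M := by
        gcongr
        exact le_max_right _ _
      linarith
    have key := le_sum_sub_query hG hij (lowerPotential M) ha hb hm
      (x := m * ((2 / M - 2 / max (a : ℝ) M) - (2 / M - 2 / max ((a - 1 : ℕ) : ℝ) M))
        + 2 / M * (crossBound a b - crossBound (a - 1) b)
        + (crossBound (min a M) b - crossBound (min (a - 1) M) b)
        - (crossRate a b - crossRate (a - 1 : ℕ) b))
      (y := 2 / M * (crossBound a b - crossBound a (b - 1))
        + (crossBound (min a M) b - crossBound (min a M) (b - 1))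
        - (crossRate a b - crossRate a (b - 1 : ℕ)))
      (fun _ m' hm' => by
        have : (m' : ℝ) * (2 / M - 2 / max ((a - 1 : ℕ) : ℝ) M) ≤
            m * (2 / M - 2 / max ((a - 1 : ℕ) : ℝ) M) :=
          mul_le_mul_of_nonneg_right (by exact_mod_cast hm') (hφ _)
        unfold lowerPotential edgeCorrection
        linarith)
      (fun _ m' hm' => by
        have : (m' : ℝ) * (2 / M - 2 / max (a : ℝ) M) ≤ m * (2 / M - 2 / max (a : ℝ) M) :=
          mul_le_mul_of_nonneg_right (by exact_mod_cast hm') (hφ _)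
        unfold lowerPotential edgeCorrection
        linarith)
    rw [ha, hb, hm]
    refine le_trans ((neg_le_pairDrop_sum hM (show m ≤ a * b by omega)).trans (le_of_eq ?_)) key
    unfold pairDrop lowerPotential edgeCorrection
    push_cast
    ring
  · refine Finset.sum_nonneg fun i _ => Finset.sum_nonneg fun j hj => ?_
    have h1 : ((classVerts ω G i).card : ℝ) ≤ 1 := by
      exact_mod_cast card_classVerts_le_one hG hU i
    have h2 : ((classVerts ω G j).card : ℝ) ≤ 1 := by
      exact_mod_cast card_classVerts_le_one hG hU j
    -- At the end each class has at most one vertex, and `crossRate 1 1 = 2` is the constant added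
    -- in `lowerPotential`.
    have h3 := crossRate_mono (Nat.cast_nonneg _) (Nat.cast_nonneg _) h1 h2
    have h4 : crossRate 1 1 = 2 := by simp [crossRate]
    have h5 := edgeCorrection_nonneg hM (classVerts ω G i).card (classVerts ω G j).card
      (crossEdges ω G i j).card
    unfold lowerPotential
    linarith

end AggGraph

/-! ### The estimate for given classes -/

/-- The number of items in class `i`. -/
def classSize {V ι : Type} [Fintype V] [DecidableEq ι] (ω : V → ι) (i : ι) : ℕ :=
  (Finset.univ.filter fun v => ω v = i).card

theorem sum_sum_Ioi_le {k : ℕ} {u : Fin k → Fin k → ℝ} {B : ℝ} (hB : 0 ≤ B)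
    (h : ∀ i j, u i j ≤ B) : ∑ i, ∑ j ∈ Finset.Ioi i, u i j ≤ k * k * B := by
  calc ∑ i, ∑ j ∈ Finset.Ioi i, u i j ≤ ∑ _i : Fin k, ∑ _j : Fin k, B := by
        refine Finset.sum_le_sum fun i _ => ?_
        exact (Finset.sum_le_sum fun j _ => h i j).trans
          (Finset.sum_le_sum_of_subset_of_nonneg (Finset.subset_univ _) fun _ _ _ => hB)
    _ = k * k * B := by simp [mul_assoc]

theorem crossBound_le {a b n : ℕ} {s : ℝ} (hs : 0 < s) (ha : a ≤ n) (hb : b ≤ n) :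
    crossBound a b ≤ s * a + b / s + 16 * √n := by
  have h1 := crossRate_le (Nat.cast_nonneg' a : (0 : ℝ) ≤ a) (Nat.cast_nonneg' b : (0 : ℝ) ≤ b) hs
  have h2 : √(a : ℝ) ≤ √n := Real.sqrt_le_sqrt (by exact_mod_cast ha)
  have h3 : √(b : ℝ) ≤ √n := Real.sqrt_le_sqrt (by exact_mod_cast hb)
  unfold crossBound
  linarith

theorem sqrt_natCast_le (n : ℕ) : √(n : ℝ) ≤ n := by
  rw [Real.sqrt_le_left (Nat.cast_nonneg n)]
  exact_mod_cast Nat.le_self_pow two_ne_zero n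

/-- For fixed M only the term 37 n / M is linear in n, and its coefficient is small when M is large.
-/
theorem edgeCorrection_zero_le {M a b n : ℕ} (hM : 1 ≤ M) (ha : a ≤ n) (hb : b ≤ n) :
    AggGraph.edgeCorrection M a b 0 ≤ M ^ 2 + 37 * n / M + 16 * √n := by
  have hM' : (0 : ℝ) < M := by exact_mod_cast hM
  have ha' : (a : ℝ) ≤ n := by exact_mod_cast ha
  have hb' : (b : ℝ) ≤ n := by exact_mod_cast hb
  -- 18 = 2 + 16: weight s = 1, and √n ≤ n. Below, 37 is 2 · 18 plus 1 from the third term.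
  have h1 : crossBound a b ≤ 18 * n := by
    have := crossBound_le one_pos ha hb
    have := sqrt_natCast_le n
    linarith
  have h2 : 2 / M * crossBound a b ≤ 36 * n / M := by
    calc 2 / M * crossBound a b ≤ 2 / M * (18 * n) := by gcongr
      _ = _ := by ring
  have h3 : crossBound (min a M) b ≤ M ^ 2 + n / M + 16 * √n := by
    refine (crossBound_le hM' ((min_le_left a M).trans ha) hb).trans ?_
    have h4 : ((min a M : ℕ) : ℝ) ≤ M := by exact_mod_cast min_le_right a M
    have h5 : (b : ℝ) / M ≤ n / M := by gcongr
    have h6 : (M : ℝ) * (min a M : ℕ) ≤ M * M := by gcongr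
    linarith
  have h4 : (37 * n / M : ℝ) = 36 * n / M + n / M := by ring
  rw [AggGraph.edgeCorrection, Nat.cast_zero, zero_mul, zero_add, h4]
  linarith

/-- For given classes, the expected number of queries between different classes, up to an error of
lower order. -/
theorem abs_meanCost_false_sub_le {k n M : ℕ} (hM : 1 ≤ M) (ω : Fin n → Fin k) :
    |AggGraph.meanCost ω (fun b => if b = false then 1 else 0) (AggGraph.initial (Fin n)) -
      ∑ i, ∑ j ∈ Finset.Ioi i, crossRate (classSize ω i) (classSize ω j)| ≤
      k * k * (M ^ 2 + 37 * n / M + 16 * √n + 2) := by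
  have hsize : ∀ i, classSize ω i ≤ n := fun i => (Finset.card_le_univ _).trans (by simp)
  have hG := AggGraph.consistent_initial ω
  rw [abs_sub_le_iff]
  constructor
  · have h := AggGraph.meanCost_false_le hG
    rw [AggGraph.pairSum] at h
    simp only [AggGraph.card_classVerts_initial, AggGraph.crossEdges_initial,
      Finset.card_empty] at h
    refine (sub_le_sub_right h _).trans ?_
    simp only [← Finset.sum_sub_distrib]
    refine sum_sum_Ioi_le (by positivity) fun i j => ?_
    have h1 : √(classSize ω i : ℝ) ≤ √n := Real.sqrt_le_sqrt (by exact_mod_cast hsize i)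
    have h2 : √(classSize ω j : ℝ) ≤ √n := Real.sqrt_le_sqrt (by exact_mod_cast hsize j)
    have h3 : AggGraph.upperPotential (classSize ω i) (classSize ω j) 0 =
        crossBound (classSize ω i) (classSize ω j) + 1 := by
      simp [AggGraph.upperPotential]
    have h4 : (0 : ℝ) ≤ M ^ 2 + 37 * n / M := by positivity
    change AggGraph.upperPotential (classSize ω i) (classSize ω j) 0 - _ ≤ _
    rw [h3, crossBound]
    linarith
  · have h := AggGraph.neg_meanCost_false_le hM hG
    rw [AggGraph.pairSum] at h
    simp only [AggGraph.card_classVerts_initial, AggGraph.crossEdges_initial,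
      Finset.card_empty] at h
    rw [sub_eq_add_neg, add_comm]
    refine (add_le_add_left h _).trans ?_
    simp only [← Finset.sum_add_distrib]
    refine sum_sum_Ioi_le (by positivity) fun i j => ?_
    have h1 := edgeCorrection_zero_le hM (hsize i) (hsize j)
    change AggGraph.lowerPotential M (classSize ω i) (classSize ω j) 0 + _ ≤ _
    rw [AggGraph.lowerPotential]
    linarith

/-! ### The sizes of the classes -/

theorem sum_fin_succ_arrow {κ : Type} [Fintype κ] [DecidableEq κ] {n : ℕ}
    (g : (Fin (n + 1) → κ) → ℝ) :
    ∑ ω, g ω = ∑ x : κ, ∑ ω : Fin n → κ, g (Fin.cons x ω) := by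
  rw [← (Fin.consEquiv fun _ : Fin (n + 1) => κ).sum_comp, Fintype.sum_prod_type]
  rfl

theorem classSize_cons {κ : Type} [DecidableEq κ] {n : ℕ} (x : κ) (ω : Fin n → κ) (i : κ) :
    (classSize (Fin.cons x ω : Fin (n + 1) → κ) i : ℝ) =
      (if x = i then 1 else 0) + classSize ω i := by
  simp only [classSize, Finset.card_filter, Fin.sum_univ_succ, Fin.cons_zero, Fin.cons_succ]
  push_cast
  rfl

section ClassSize

variable {k : ℕ} {p : Fin k → ℝ}

theorem sum_prod_eq_one (hp : ∑ i, p i = 1) (n : ℕ) :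
    ∑ ω : Fin n → Fin k, ∏ u, p (ω u) = 1 := by
  induction n with
  | zero => simp
  | succ n ih =>
    rw [sum_fin_succ_arrow]
    simp only [Fin.prod_univ_succ, Fin.cons_zero, Fin.cons_succ, ← Finset.mul_sum, ih, mul_one, hp]

theorem sum_mul_indicator_sub (hp : ∑ i, p i = 1) (i : Fin k) :
    ∑ x, p x * ((if x = i then 1 else 0) - p i) = 0 := by
  simp [mul_sub, ← Finset.sum_mul, hp]

theorem sum_mul_indicator_sub_sq (hp : ∑ i, p i = 1) (i : Fin k) :
    ∑ x, p x * ((if x = i then 1 else 0) - p i) ^ 2 = p i * (1 - p i) := by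
  have h : ∀ x, p x * ((if x = i then (1 : ℝ) else 0) - p i) ^ 2 =
      (if x = i then p x * (1 - 2 * p i) else 0) + p x * p i ^ 2 := by
    intro x
    split_ifs <;> ring
  simp only [h, Finset.sum_add_distrib, ← Finset.sum_mul, hp]
  simp
  ring

/-- The vanishing first moment removes the cross term in the induction for the variance. -/
theorem sum_prod_mul_sub (hp : ∑ i, p i = 1) (n : ℕ) (i : Fin k) :
    ∑ ω : Fin n → Fin k, (∏ u, p (ω u)) * (classSize ω i - n * p i) = 0 := by
  induction n with
  | zero => simp [classSize]
  | succ n ih =>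
    rw [sum_fin_succ_arrow]
    have h : ∀ (x : Fin k) (ω : Fin n → Fin k),
        (∏ u, p ((Fin.cons x ω : Fin (n + 1) → Fin k) u)) *
          (classSize (Fin.cons x ω : Fin (n + 1) → Fin k) i - (n + 1 : ℕ) * p i) =
        p x * ((if x = i then 1 else 0) - p i) * ∏ u, p (ω u) +
          p x * ((∏ u, p (ω u)) * (classSize ω i - n * p i)) := by
      intro x ω
      rw [classSize_cons, Fin.prod_univ_succ]
      simp only [Fin.cons_zero, Fin.cons_succ]
      push_cast
      ring
    simp only [h, Finset.sum_add_distrib, ← Finset.mul_sum, ih, sum_prod_eq_one hp, mul_one,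
      mul_zero, sum_mul_indicator_sub hp, add_zero]

theorem sum_prod_mul_sub_sq (hp : ∑ i, p i = 1) (n : ℕ) (i : Fin k) :
    ∑ ω : Fin n → Fin k, (∏ u, p (ω u)) * (classSize ω i - n * p i) ^ 2 =
      n * (p i * (1 - p i)) := by
  induction n with
  | zero => simp [classSize]
  | succ n ih =>
    rw [sum_fin_succ_arrow]
    have h : ∀ (x : Fin k) (ω : Fin n → Fin k),
        (∏ u, p ((Fin.cons x ω : Fin (n + 1) → Fin k) u)) *
          (classSize (Fin.cons x ω : Fin (n + 1) → Fin k) i - (n + 1 : ℕ) * p i) ^ 2 =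
        p x * ((if x = i then 1 else 0) - p i) ^ 2 * ∏ u, p (ω u) +
          2 * (p x * ((if x = i then 1 else 0) - p i)) *
            ((∏ u, p (ω u)) * (classSize ω i - n * p i)) +
          p x * ((∏ u, p (ω u)) * (classSize ω i - n * p i) ^ 2) := by
      intro x ω
      rw [classSize_cons, Fin.prod_univ_succ]
      simp only [Fin.cons_zero, Fin.cons_succ]
      push_cast
      ring
    simp only [h, Finset.sum_add_distrib, ← Finset.mul_sum, ih, sum_prod_eq_one hp, mul_one,
      sum_prod_mul_sub hp, mul_zero, sum_mul_indicator_sub_sq hp, add_zero,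
      ← Finset.sum_mul, hp]
    push_cast
    ring

theorem sum_prod_mul_abs_sub_le (hp0 : ∀ i, 0 ≤ p i) (hp : ∑ i, p i = 1) (n : ℕ) (i : Fin k) :
    ∑ ω : Fin n → Fin k, (∏ u, p (ω u)) * |classSize ω i - n * p i| ≤ √n := by
  rcases n.eq_zero_or_pos with rfl | hn
  · simp [classSize]
  have hs : 0 < √(n : ℝ) := Real.sqrt_pos.2 (by exact_mod_cast hn)
  have hs2 : √(n : ℝ) * √n = n := Real.mul_self_sqrt (Nat.cast_nonneg n)
  -- AM–GM, |x| ≤ x² / (2√n) + √n / 2, plays the part of Cauchy–Schwarz.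
  have h1 : ∀ ω : Fin n → Fin k, (∏ u, p (ω u)) * |classSize ω i - n * p i| ≤
      1 / (2 * √n) * ((∏ u, p (ω u)) * (classSize ω i - n * p i) ^ 2) +
        √n / 2 * ∏ u, p (ω u) := by
    intro ω
    have h2 : |classSize ω i - n * p i| ≤
        1 / (2 * √n) * (classSize ω i - n * p i) ^ 2 + √n / 2 := by
      rw [← sq_abs (classSize ω i - n * p i)]
      have h3 : 0 ≤ 1 / (2 * √(n : ℝ)) * (|classSize ω i - n * p i| - √n) ^ 2 := by positivity
      have h4 : 1 / (2 * √(n : ℝ)) * (|classSize ω i - n * p i| - √n) ^ 2 =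
          1 / (2 * √n) * |classSize ω i - n * p i| ^ 2 + √n / 2 - |classSize ω i - n * p i| := by
        field_simp
        ring
      linarith
    have h5 : 0 ≤ ∏ u, p (ω u) := Finset.prod_nonneg fun u _ => hp0 _
    calc _ ≤ (∏ u, p (ω u)) * (1 / (2 * √n) * (classSize ω i - n * p i) ^ 2 + √n / 2) := by gcongr
      _ = _ := by ring
  refine (Finset.sum_le_sum fun ω _ => h1 ω).trans ?_
  rw [Finset.sum_add_distrib, ← Finset.mul_sum, ← Finset.mul_sum, sum_prod_mul_sub_sq hp,
    sum_prod_eq_one hp]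
  have h6 : p i * (1 - p i) ≤ 1 := by nlinarith [sq_nonneg (p i - 1 / 2)]
  calc 1 / (2 * √(n : ℝ)) * (n * (p i * (1 - p i))) + √n / 2 * 1
      ≤ 1 / (2 * √(n : ℝ)) * (n * 1) + √n / 2 * 1 := by gcongr
    _ = √n := by
      nth_rw 2 [← hs2]
      field_simp
      ring

/-- With u, v the two deviations divided by α, β, the point (a, b) lies coordinatewise between (n -
u - v)(α, β) and (n + u + v)(α, β); monotonicity and homogeneity do the rest. -/
theorem abs_crossRate_sub_le {a b n α β : ℝ} (ha : 0 ≤ a) (hb : 0 ≤ b) (hn : 0 < n) (hα : 0 < α)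
    (hβ : 0 < β) :
    |crossRate a b - n * crossRate α β| ≤
      crossRate α β * (|a - n * α| / α + |b - n * β| / β) := by
  have hf := (crossRate_pos hα hβ).le
  have hu : 0 ≤ |a - n * α| / α := by positivity
  have hv : 0 ≤ |b - n * β| / β := by positivity
  have hu' : |a - n * α| / α * α = |a - n * α| := by field_simp
  have hv' : |b - n * β| / β * β = |b - n * β| := by field_simp
  have ha1 := abs_le.1 (le_refl |a - n * α|)
  have hb1 := abs_le.1 (le_refl |b - n * β|)
  generalize |a - n * α| / α = u at *
  generalize |b - n * β| / β = v at *
  rw [abs_sub_le_iff]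
  have huα := mul_nonneg hu hβ.le
  have hvα := mul_nonneg hv hα.le
  constructor
  · have h1 : crossRate a b ≤ crossRate ((n + (u + v)) * α) ((n + (u + v)) * β) :=
      crossRate_mono ha hb (by linarith) (by linarith)
    rw [crossRate_mul (by positivity)] at h1
    linarith
  -- For a nonpositive scale factor the bound reduces to `crossRate` being nonnegative.
  · rcases le_or_gt (n - (u + v)) 0 with h | h
    · have h1 := crossRate_nonneg ha hb
      have h2 := mul_nonneg (neg_nonneg.2 h) hf
      linarith
    · have h1 : crossRate ((n - (u + v)) * α) ((n - (u + v)) * β) ≤ crossRate a b :=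
        crossRate_mono (by positivity) (by positivity) (by linarith) (by linarith)
      rw [crossRate_mul h] at h1
      linarith

theorem classSize_eq_zero {n : ℕ} {ω : Fin n → Fin k} (hω : ∏ u, p (ω u) ≠ 0) {i : Fin k}
    (hi : p i = 0) : classSize ω i = 0 := by
  rw [classSize, Finset.card_eq_zero, Finset.filter_eq_empty_iff]
  rintro u - rfl
  exact hω (Finset.prod_eq_zero (Finset.mem_univ u) hi)

/-- A class of probability 0 is empty in every assignment of nonzero weight, so both sides vanish
then; otherwise the mean deviation bound applies. -/
theorem sum_prod_mul_abs_crossRate_sub_le (hp0 : ∀ i, 0 ≤ p i) (hp : ∑ i, p i = 1) {n : ℕ}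
    (hn : 0 < n) (i j : Fin k) :
    ∑ ω : Fin n → Fin k, (∏ u, p (ω u)) *
        |crossRate (classSize ω i) (classSize ω j) - n * crossRate (p i) (p j)| ≤
      crossRate (p i) (p j) * (1 / p i + 1 / p j) * √n := by
  by_cases hij : p i = 0 ∨ p j = 0
  · have h0 : crossRate (p i) (p j) = 0 := by
      rcases hij with h | h
      · rw [h, crossRate_zero_left]
      · rw [h, crossRate_zero_right]
    rw [h0, zero_mul, zero_mul]
    refine (Finset.sum_eq_zero fun ω _ => ?_).le
    by_cases hω : ∏ u, p (ω u) = 0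
    · rw [hω, zero_mul]
    · rcases hij with h | h
      · simp [classSize_eq_zero hω h, crossRate_zero_left]
      · simp [classSize_eq_zero hω h, crossRate_zero_right]
  · push Not at hij
    have hi := (hp0 i).lt_of_ne' hij.1
    have hj := (hp0 j).lt_of_ne' hij.2
    have hf := (crossRate_pos hi hj).le
    have h1 := sum_prod_mul_abs_sub_le hp0 hp n i
    have h2 := sum_prod_mul_abs_sub_le hp0 hp n j
    calc _ ≤ ∑ ω : Fin n → Fin k, (crossRate (p i) (p j) * (1 / p i) *
            ((∏ u, p (ω u)) * |classSize ω i - n * p i|) + crossRate (p i) (p j) * (1 / p j) *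
            ((∏ u, p (ω u)) * |classSize ω j - n * p j|)) := by
          refine Finset.sum_le_sum fun ω _ => ?_
          have h3 := abs_crossRate_sub_le (Nat.cast_nonneg' (classSize ω i))
            (Nat.cast_nonneg' (classSize ω j)) (show (0 : ℝ) < n by exact_mod_cast hn) hi hj
          have h4 : 0 ≤ ∏ u, p (ω u) := Finset.prod_nonneg fun u _ => hp0 _
          refine (mul_le_mul_of_nonneg_left h3 h4).trans (le_of_eq ?_)
          ring
      _ ≤ crossRate (p i) (p j) * (1 / p i) * √n + crossRate (p i) (p j) * (1 / p j) * √n := by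
          rw [Finset.sum_add_distrib, ← Finset.mul_sum, ← Finset.mul_sum]
          gcongr
      _ = _ := by ring

end ClassSize

/-! ### The expected numbers of queries -/

section Expected

variable {k : ℕ} {p : Fin k → ℝ}

theorem toReal_expectedCost (hp0 : ∀ i, 0 ≤ p i) (n : ℕ) (w : Bool → ℕ) (X : List Bool → ℕ)
    (hX0 : X [] = 0) (hX : ∀ b l, X (b :: l) = w b + X l) :
    (expectedCost p n X).toReal = ∑ ω : Fin n → Fin k, (∏ u, p (ω u)) *
      AggGraph.meanCost ω (fun b => (w b : ℝ)) (AggGraph.initial (Fin n)) := by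
  simp only [expectedCost, AggGraph.tsum_randomRun_mul _ w X hX0 hX]
  rw [ENNReal.toReal_sum fun ω _ => ENNReal.mul_ne_top ENNReal.ofReal_ne_top ENNReal.ofReal_ne_top]
  refine Finset.sum_congr rfl fun ω _ => ?_
  rw [ENNReal.toReal_mul, ENNReal.toReal_ofReal (Finset.prod_nonneg fun u _ => hp0 _),
    ENNReal.toReal_ofReal (AggGraph.meanCost_nonneg (fun b => Nat.cast_nonneg _) _)]

theorem expectedCrossQueries_eq (hp0 : ∀ i, 0 ≤ p i) (n : ℕ) :
    expectedCrossQueries p n = ∑ ω : Fin n → Fin k, (∏ u, p (ω u)) *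
      AggGraph.meanCost ω (fun b => if b = false then 1 else 0) (AggGraph.initial (Fin n)) := by
  rw [expectedCrossQueries, toReal_expectedCost hp0 n (fun b => if b = false then 1 else 0)]
  · simp only [Nat.cast_ite, Nat.cast_one, Nat.cast_zero]
  · rfl
  · intro b l
    rw [List.count_cons, add_comm]
    simp

theorem expectedQueries_eq (hp0 : ∀ i, 0 ≤ p i) (n : ℕ) :
    expectedQueries p n = ∑ ω : Fin n → Fin k, (∏ u, p (ω u)) *
      AggGraph.meanCost ω (fun b => if b = true then 1 else 0) (AggGraph.initial (Fin n)) +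
        expectedCrossQueries p n := by
  rw [expectedCrossQueries_eq hp0, expectedQueries, toReal_expectedCost hp0 n (fun _ => 1),
    ← Finset.sum_add_distrib]
  · refine Finset.sum_congr rfl fun ω _ => ?_
    rw [← mul_add, ← AggGraph.meanCost_add]
    congr 2
    funext b
    cases b <;> simp
  · rfl
  · intro b l
    rw [List.length_cons, add_comm]

theorem abs_expectedQueries_sub_le (hp0 : ∀ i, 0 ≤ p i) (hp : ∑ i, p i = 1) (n : ℕ) :
    |expectedQueries p n - expectedCrossQueries p n - (n - k)| ≤ k := by
  have hw : ∀ ω : Fin n → Fin k, 0 ≤ ∏ u, p (ω u) := fun ω => Finset.prod_nonneg fun u _ => hp0 _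
  have hlow : (n - k : ℝ) = ∑ ω : Fin n → Fin k, (∏ u, p (ω u)) * (n - k : ℝ) := by
    rw [← Finset.sum_mul, sum_prod_eq_one hp, one_mul]
  have hup : (n : ℝ) = ∑ ω : Fin n → Fin k, (∏ u, p (ω u)) * (n : ℝ) := by
    rw [← Finset.sum_mul, sum_prod_eq_one hp, one_mul]
  have h1 : (n - k : ℝ) ≤ ∑ ω : Fin n → Fin k, (∏ u, p (ω u)) *
      AggGraph.meanCost ω (fun b => if b = true then 1 else 0) (AggGraph.initial (Fin n)) := by
    rw [hlow]
    refine Finset.sum_le_sum fun ω _ => mul_le_mul_of_nonneg_left ?_ (hw ω)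
    simpa [AggGraph.card_verts_initial] using
      AggGraph.le_meanCost_true (AggGraph.consistent_initial ω)
  have h2 : ∑ ω : Fin n → Fin k, (∏ u, p (ω u)) * AggGraph.meanCost ω
      (fun b => if b = true then 1 else 0) (AggGraph.initial (Fin n)) ≤ (n : ℝ) := by
    conv_rhs => rw [hup]
    refine Finset.sum_le_sum fun ω _ => mul_le_mul_of_nonneg_left ?_ (hw ω)
    simpa [AggGraph.card_verts_initial] using
      AggGraph.meanCost_true_le (AggGraph.consistent_initial ω)
  have hk : (0 : ℝ) ≤ k := Nat.cast_nonneg k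
  rw [expectedQueries_eq hp0, abs_le]
  constructor <;> linarith

/-- The triangle inequality through `crossRate` at the actual class sizes: the first error comes
from the algorithm, the second from the random sizes. -/
theorem abs_expectedCrossQueries_sub_le (hp0 : ∀ i, 0 ≤ p i) (hp : ∑ i, p i = 1) {n M : ℕ}
    (hn : 0 < n) (hM : 1 ≤ M) :
    |expectedCrossQueries p n - (∑ i, ∑ j ∈ Finset.Ioi i, crossRate (p i) (p j)) * n| ≤
      k * k * (M ^ 2 + 37 * n / M + 16 * √n + 2) +
        (∑ i, ∑ j ∈ Finset.Ioi i, crossRate (p i) (p j) * (1 / p i + 1 / p j)) * √n := by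
  have hw : ∀ ω : Fin n → Fin k, 0 ≤ ∏ u, p (ω u) := fun ω => Finset.prod_nonneg fun u _ => hp0 _
  set c := ∑ i, ∑ j ∈ Finset.Ioi i, crossRate (p i) (p j) with hc
  have hcn : c * n = ∑ ω : Fin n → Fin k, (∏ u, p (ω u)) * (c * n) := by
    rw [← Finset.sum_mul, sum_prod_eq_one hp, one_mul]
  rw [expectedCrossQueries_eq hp0, hcn, ← Finset.sum_sub_distrib]
  have hterm : ∀ ω : Fin n → Fin k, |(∏ u, p (ω u)) * AggGraph.meanCost ω
      (fun b => if b = false then 1 else 0) (AggGraph.initial (Fin n)) -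
        (∏ u, p (ω u)) * (c * n)| ≤
      (∏ u, p (ω u)) * (k * k * (M ^ 2 + 37 * n / M + 16 * √n + 2)) +
      ∑ i, ∑ j ∈ Finset.Ioi i, (∏ u, p (ω u)) *
        |crossRate (classSize ω i) (classSize ω j) - n * crossRate (p i) (p j)| := by
    intro ω
    rw [← mul_sub, abs_mul, abs_of_nonneg (hw ω)]
    simp only [← Finset.mul_sum]
    rw [← mul_add]
    refine mul_le_mul_of_nonneg_left ?_ (hw ω)
    refine (abs_sub_le _ (∑ i, ∑ j ∈ Finset.Ioi i, crossRate (classSize ω i) (classSize ω j))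
      _).trans (add_le_add (abs_meanCost_false_sub_le hM ω) ?_)
    rw [hc, mul_comm, Finset.mul_sum, ← Finset.sum_sub_distrib]
    refine (Finset.abs_sum_le_sum_abs _ _).trans (Finset.sum_le_sum fun i _ => ?_)
    rw [Finset.mul_sum, ← Finset.sum_sub_distrib]
    exact Finset.abs_sum_le_sum_abs _ _
  refine (Finset.abs_sum_le_sum_abs _ _).trans ((Finset.sum_le_sum fun ω _ => hterm ω).trans ?_)
  rw [Finset.sum_add_distrib, ← Finset.sum_mul, sum_prod_eq_one hp, one_mul]
  refine add_le_add_right ?_ _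
  rw [Finset.sum_comm, Finset.sum_mul]
  refine Finset.sum_le_sum fun i _ => ?_
  rw [Finset.sum_comm, Finset.sum_mul]
  exact Finset.sum_le_sum fun j _ => sum_prod_mul_abs_crossRate_sub_le hp0 hp hn i j

theorem isLittleO_expectedCrossQueries_sub (hp0 : ∀ i, 0 ≤ p i) (hp : ∑ i, p i = 1) :
    (fun n : ℕ => expectedCrossQueries p n -
      (∑ i, ∑ j ∈ Finset.Ioi i, crossRate (p i) (p j)) * n) =o[atTop] fun n : ℕ => (n : ℝ) := by
  rw [isLittleO_iff]
  intro ε hε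
  -- This M makes the linear error k² · 37 n / M at most ε n / 2; everything else is O(√n) once M is
  -- fixed.
  obtain ⟨M, hM⟩ := exists_nat_gt (max 1 (k * k * 37 * 2 / ε))
  have hM1 : (1 : ℝ) < M := (le_max_left _ _).trans_lt hM
  have hM2 : k * k * 37 * 2 / ε < M := (le_max_right _ _).trans_lt hM
  set C := ∑ i, ∑ j ∈ Finset.Ioi i, crossRate (p i) (p j) * (1 / p i + 1 / p j)
  have hC : 0 ≤ C := Finset.sum_nonneg fun i _ => Finset.sum_nonneg fun j _ =>
    mul_nonneg (crossRate_nonneg (hp0 i) (hp0 j))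
      (add_nonneg (one_div_nonneg.2 (hp0 i)) (one_div_nonneg.2 (hp0 j)))
  -- 18 = 16 + 2, the constant 2 being absorbed through 1 ≤ √n.
  set D : ℝ := k * k * (M ^ 2 + 18) + C
  have hlim : Tendsto (fun n : ℕ => √(n : ℝ)) atTop atTop :=
    Real.tendsto_sqrt_atTop.comp tendsto_natCast_atTop_atTop
  filter_upwards [hlim.eventually_ge_atTop (max 1 (D * 2 / ε)), eventually_gt_atTop 0] with n hn hn0
  have hn1 : 1 ≤ √(n : ℝ) := (le_max_left _ _).trans hn
  have hn2 : D * 2 / ε ≤ √(n : ℝ) := (le_max_right _ _).trans hn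
  have hs2 : √(n : ℝ) * √n = n := Real.mul_self_sqrt (Nat.cast_nonneg n)
  rw [Real.norm_eq_abs, Real.norm_of_nonneg (Nat.cast_nonneg n)]
  refine (abs_expectedCrossQueries_sub_le hp0 hp hn0
    (show 1 ≤ M by exact_mod_cast hM1.le)).trans ?_
  have hM0 : (0 : ℝ) < M := by linarith
  have h1 : k * k * (37 * n / M) ≤ ε / 2 * n := by
    have h2 : k * k * 37 / M ≤ ε / 2 := by
      rw [div_lt_iff₀ hε] at hM2
      rw [div_le_iff₀ hM0]
      linarith
    calc (k * k * (37 * n / M) : ℝ) = k * k * 37 / M * n := by ring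
      _ ≤ _ := by gcongr
  have h2 : D * √n ≤ ε / 2 * n := by
    have h3 : D ≤ ε / 2 * √n := by
      rw [div_le_iff₀ hε] at hn2
      linarith
    calc D * √n ≤ ε / 2 * √n * √n := by gcongr
      _ = ε / 2 * n := by rw [mul_assoc, hs2]
  have h3 : (k * k * (M ^ 2 + 2) : ℝ) * 1 ≤ k * k * (M ^ 2 + 2) * √n := by gcongr
  have h4 : D * √n = k * k * (M ^ 2 + 2) * √n + k * k * 16 * √n + C * √n := by
    simp only [D]
    ring
  calc k * k * (M ^ 2 + 37 * n / M + 16 * √n + 2) + C * √n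
      = k * k * (37 * n / M) + (k * k * (M ^ 2 + 2) * 1 + k * k * 16 * √n + C * √n) := by ring
    _ ≤ ε / 2 * n + ε / 2 * n := by linarith
    _ = ε * n := by ring

/-- Equivalence to the zero sequence requires actual vanishing, which o(n) does not give. Here at
most one class has positive probability, so every assignment of nonzero weight is constant. -/
theorem expectedCrossQueries_eq_zero (hp0 : ∀ i, 0 ≤ p i)
    (hc : ∑ i, ∑ j ∈ Finset.Ioi i, crossRate (p i) (p j) = 0) (n : ℕ) :
    expectedCrossQueries p n = 0 := by
  have hnn : ∀ i j, 0 ≤ crossRate (p i) (p j) := fun i j => crossRate_nonneg (hp0 i) (hp0 j)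
  have h0 : ∀ i j, i < j → crossRate (p i) (p j) = 0 := fun i j hij =>
    (Finset.sum_eq_zero_iff_of_nonneg fun j _ => hnn i j).1
      ((Finset.sum_eq_zero_iff_of_nonneg fun i _ => Finset.sum_nonneg fun j _ => hnn i j).1 hc i
        (Finset.mem_univ i)) j (Finset.mem_Ioi.2 hij)
  rw [expectedCrossQueries_eq hp0]
  refine Finset.sum_eq_zero fun ω _ => ?_
  by_cases hω : ∏ u, p (ω u) = 0
  · rw [hω, zero_mul]
  · have hpos : ∀ u, 0 < p (ω u) := fun u =>
      (hp0 _).lt_of_ne' (Finset.prod_ne_zero_iff.1 hω u (Finset.mem_univ u))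
    rw [AggGraph.meanCost_false_of_const _ (AggGraph.consistent_initial ω), mul_zero]
    intro u v
    by_contra huv
    rcases lt_or_gt_of_ne huv with h | h
    · exact (crossRate_pos (hpos u) (hpos v)).ne' (h0 _ _ h)
    · exact (crossRate_pos (hpos v) (hpos u)).ne' (h0 _ _ h)

end Expected

/-! ### The asymptotic equivalences -/

theorem theorem5 (k : ℕ) (p : Fin k → ℝ) (hp_nonneg : ∀ i, 0 ≤ p i) (hp_anti : Antitone p)
    (hp_sum : ∑ i, p i = 1) :
    ((fun n : ℕ => expectedQueries p n) ~[atTop]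
      fun n : ℕ => (n : ℝ) - k + ∑ i, ∑ j ∈ Finset.Ioi i, crossRate (p i) (p j) * n) ∧
    ((fun n : ℕ => expectedCrossQueries p n) ~[atTop]
      fun n : ℕ => ∑ i, ∑ j ∈ Finset.Ioi i, crossRate (p i) (p j) * n) := by
  simp only [← Finset.sum_mul]
  have hY := isLittleO_expectedCrossQueries_sub hp_nonneg hp_sum
  have hc0 : 0 ≤ ∑ i, ∑ j ∈ Finset.Ioi i, crossRate (p i) (p j) :=
    Finset.sum_nonneg fun i _ => Finset.sum_nonneg fun j _ =>
      crossRate_nonneg (hp_nonneg i) (hp_nonneg j)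
  have hzero := expectedCrossQueries_eq_zero hp_nonneg
  generalize ∑ i, ∑ j ∈ Finset.Ioi i, crossRate (p i) (p j) = c at *
  constructor
  · have h1 : (fun n : ℕ => expectedQueries p n - expectedCrossQueries p n - (n - k)) =o[atTop]
        fun n : ℕ => (n : ℝ) := by
      refine IsBigO.trans_isLittleO (g := fun _ => (1 : ℝ)) ?_ ?_
      · refine IsBigO.of_bound k (Eventually.of_forall fun n => ?_)
        rw [Real.norm_eq_abs, norm_one, mul_one]
        exact abs_expectedQueries_sub_le hp_nonneg hp_sum n
      · exact (isLittleO_const_left.2 (Or.inr (tendsto_norm_atTop_atTop.comp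
          tendsto_natCast_atTop_atTop)))
    -- For n ≥ 2k the target is at least n - k ≥ n / 2, so an o(n) error is negligible even when c =
    -- 0.
    have h2 : (fun n : ℕ => (n : ℝ)) =O[atTop] fun n : ℕ => (n : ℝ) - k + c * n := by
      refine IsBigO.of_bound 2 ?_
      filter_upwards [eventually_ge_atTop (2 * k)] with n hn
      have hn' : (2 * k : ℝ) ≤ n := by exact_mod_cast hn
      have hcn : 0 ≤ c * n := by positivity
      rw [Real.norm_of_nonneg (Nat.cast_nonneg n), Real.norm_of_nonneg]
      · linarith
      · have : (0 : ℝ) ≤ k := Nat.cast_nonneg k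
        linarith
    refine IsLittleO.trans_isBigO ((h1.add hY).congr_left fun n => ?_) h2
    simp only [Pi.sub_apply]
    ring
  · rcases hc0.eq_or_lt with rfl | hc
    · simp only [hzero rfl, zero_mul]
      exact IsEquivalent.refl
    · exact hY.trans_isBigO (isBigO_const_mul_self c⁻¹ _ _ |>.congr_left fun n => by
        rw [inv_mul_cancel_left₀ hc.ne'])
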